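/- Let $n\ge 0$ and $u\in\mathfrak S_n$. Write $s_i=(i\ i{+}1)$ $(1\le i\le n)$ for the simple transpositions of $\mathfrak S_{n+1}$, $s(1,n)=s_1s_2\cdots s_n$, and let $\mathsf h(u)\in\mathfrak S_{n+1}$ be the permutation with one-line notation $1,\,u(1)+1,\dots,u(n)+1$. For $v\le w$ in the Bruhat order of $\mathfrak S_{n+1}$ (a reduced expression of $v$ is a subword of some reduced expression of $w$) let $$\mathsf Q_{v,w}=\operatorname{Conv}\{(z(1),\dots,z(n+1))\in\mathbb R^{n+1}\mid v\le z\le w\}$$ be the Bruhat interval polytope. It lies in a hyperplane $\sum x_i=\text{const}$. Let $M=\{x\in\mathbb Z^{n+1}\mid\sum x_i=0\}$, $N=\mathbb Z^{n+1}/\mathbb Z(1,\dots,1)$, paired by the dot product. The (inner) normal fan of $\mathsf Q_{v,w}$ is the set of cones $$\{\xi\in N\otimes\mathbb R\mid \langle\xi,z-y\rangle\ge 0\text{ for all }y\in F,\ z\in \mathsf Q_{v,w}\},$$ where $F$ runs over the nonempty faces of $\mathsf Q_{v,w}$. Let $T$ be a triangulation of the convex $(n+2)$-gon with vertices labelled $0,1,\dots,n+1$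 counterclockwise. Starting with the distinguished edge $\{0,n+1\}$, proceed inductively: if $a<k<b$ are the vertices of the triangle of $T$ at a distinguished edge $\{a,b\}$ in the part of the polygon with vertices $a,a+1,\dots,b$, then put $\{a,k\}$ in the left tree and $\{k,b\}$ in the right tree of $T$, and continue with $\{a,k\}$ and $\{k,b\}$ as distinguished edges of the two remaining parts. For each $1\le k\le n$ there are a unique edge $\{k_L,k\}$ with $k_L<k$ in the left tree and a unique edge $\{k,k_R\}$ with $k<k_R$ in the right tree. With $\varpi_i\in N$ the class of $e_1+\dots+e_i$ $(0\le i\le n+1)$, put $$\mathbf v_k=\varpi_k-\varpi_{k_R},\qquad \mathbf w_k=\varpi_{k_L}-\varpi_k\qquad(1\le k\le n),$$ and let $\Sigma_T$ be the set of the cones $\operatorname{Cone}(Q)\subset N\otimes\mathbb R$, where $Q$ runs over the subsets of $\{\mathbf v_k,\mathbf w_k\mid 1\le k\le n\}$ with $\{\mathbf v_i,\mathbf w_i\}\not\subset Q$ for all $i$. The binary tree $\mathcal B_T$ of $T$ has the triangle at the edge $\{0,n+1\}$, with vertices $0<k<n+1$, as its root; its left and right subtrees are obtained in the same way from the parts of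 $T$ cut off by $\{0,k\}$ and $\{k,n+1\}$, a single edge giving the empty tree. The map $T\mapsto\mathcal B_T$ is a bijection onto the binary trees with $n$ vertices. The binary tree of a sequence of distinct integers has the smallest entry as its root, and its left and right subtrees are the binary trees of the subsequences to the left and to the right of that entry, the empty sequence giving the empty tree. Let $\psi(u)$ be the triangulation of the $(n+2)$-gon whose binary tree is the binary tree of the sequence $u(1),u(2),\dots,u(n)$. Theorem. For every $u\in\mathfrak S_n$, the normal fan of the Bruhat interval polytope $\mathsf Q_{\mathsf h(u),\,\mathsf h(u)s(1,n)}$ is equal to the fan $\Sigma_{\psi(u)}$. -/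

import Mathlib

noncomputable section

open scoped Matrix

namespace CatalanFan

/-! ## Permutations and the Bruhat order

A permutation of `{1, ..., m}` is an element of `Equiv.Perm (Fin m)`; the element `i : Fin m`
stands for the number `i + 1`. Products are compositions: `(x * y) i = x (y i)`. -/

/-- The simple transposition `s_i`, `1 ≤ i ≤ n`, of the symmetric group on `n + 1` letters. -/
def simpleTransposition {n : ℕ} (i : Fin n) : Equiv.Perm (Fin (n + 1)) :=
  Equiv.swap i.castSucc i.succ

/-- The product `s_{i_1} s_{i_2} ⋯ s_{i_l}` of a word in the simple transpositions. -/
def wordProd {n : ℕ} (l : List (Fin n)) : Equiv.Perm (Fin (n + 1)) :=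
  (l.map simpleTransposition).prod

/-- `l` is a reduced expression of `w`: its product is `w`, and no word with product `w` is
shorter. -/
def IsReducedWord {n : ℕ} (w : Equiv.Perm (Fin (n + 1))) (l : List (Fin n)) : Prop :=
  wordProd l = w ∧ ∀ l' : List (Fin n), wordProd l' = w → l.length ≤ l'.length

/-- The Bruhat order: a reduced expression of `v` is a (not necessarily contiguous) subword of a
reduced expression of `w`. -/
def BruhatLE {n : ℕ} (v w : Equiv.Perm (Fin (n + 1))) : Prop :=
  ∃ lv lw : List (Fin n), IsReducedWord v lv ∧ IsReducedWord w lw ∧ lv.Sublist lw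

/-- The permutation `1, u(1) + 1, ..., u(n) + 1` (one-line notation) on `n + 1` letters. -/
def head {n : ℕ} (u : Equiv.Perm (Fin n)) : Equiv.Perm (Fin (n + 1)) where
  toFun := Fin.cases 0 fun i => (u i).succ
  invFun := Fin.cases 0 fun i => (u.symm i).succ
  left_inv i := by induction i using Fin.cases <;> simp
  right_inv i := by induction i using Fin.cases <;> simp

/-- The permutation `s(1, n) = s_1 s_2 ⋯ s_n`. -/
def ascendingProd (n : ℕ) : Equiv.Perm (Fin (n + 1)) :=
  wordProd (List.finRange n)

/-- The point `(z(1), ..., z(n+1))` of `ℝ^(n+1)`. -/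
def permPoint {n : ℕ} (z : Equiv.Perm (Fin (n + 1))) : Fin (n + 1) → ℝ :=
  fun i => ((z i : ℕ) : ℝ) + 1

/-- The Bruhat interval polytope `Q_{v,w}`. -/
def bruhatIntervalPolytope {n : ℕ} (v w : Equiv.Perm (Fin (n + 1))) : Set (Fin (n + 1) → ℝ) :=
  convexHull ℝ {p | ∃ z, BruhatLE v z ∧ BruhatLE z w ∧ p = permPoint z}

/-! ## The spaces `M ⊗ ℝ` and `N ⊗ ℝ`, and normal fans -/

/-- `M ⊗ ℝ`: the vectors in `ℝ^(n+1)` with coordinate sum zero. -/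
def MR (n : ℕ) : Submodule ℝ (Fin (n + 1) → ℝ) where
  carrier := {x | ∑ i, x i = 0}
  add_mem' := by
    intro x y hx hy
    simp only [Set.mem_ofPred_eq] at hx hy
    simp [Finset.sum_add_distrib, hx, hy]
  zero_mem' := by simp
  smul_mem' := by
    intro c x hx
    simp only [Set.mem_ofPred_eq] at hx
    simp [← Finset.mul_sum, hx]

/-- `N ⊗ ℝ`: the quotient of `ℝ^(n+1)` by the line through `(1, ..., 1)`. -/
abbrev NR (n : ℕ) : Type :=
  (Fin (n + 1) → ℝ) ⧸ Submodule.span ℝ {(fun _ => 1 : Fin (n + 1) → ℝ)}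

/-- The image in `N ⊗ ℝ` of a vector of `ℝ^(n+1)`. -/
def toNR (n : ℕ) : (Fin (n + 1) → ℝ) →ₗ[ℝ] NR n :=
  Submodule.mkQ _

/-- The pairing of `N ⊗ ℝ` and `M ⊗ ℝ` induced by the dot product on `ℝ^(n+1)`. -/
def pairing (n : ℕ) : NR n →ₗ[ℝ] MR n →ₗ[ℝ] ℝ :=
  Submodule.liftQ _
    (LinearMap.mk₂ ℝ (fun (x : Fin (n + 1) → ℝ) (m : MR n) => x ⬝ᵥ (m : Fin (n + 1) → ℝ))
      (fun x y m => add_dotProduct x y _) (fun c x m => smul_dotProduct c x _)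
      (fun x m m' => dotProduct_add x _ _) (fun c x m => dotProduct_smul c x _))
    (by
      rw [Submodule.span_singleton_le_iff_mem, LinearMap.mem_ker]
      ext m
      have h : ∑ i, (m : Fin (n + 1) → ℝ) i = 0 := m.2
      simpa [dotProduct] using h)

@[simp]
theorem pairing_toNR (n : ℕ) (x : Fin (n + 1) → ℝ) (m : MR n) :
    pairing n (toNR n x) m = x ⬝ᵥ (m : Fin (n + 1) → ℝ) := rfl

/-- The inner normal cone in `N ⊗ ℝ` of a subset `F` (a face) of `P`: the `ξ` such that
`⟨ξ, z - y⟩ ≥ 0` for all `y ∈ F`, `z ∈ P`. It is used for sets `P` that lie in a hyperplane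
`∑ i, x i = const`, so that `z - y` is always in `M ⊗ ℝ`. -/
def normalCone {n : ℕ} (P F : Set (Fin (n + 1) → ℝ)) : PointedCone ℝ (NR n) where
  carrier := {ξ | ∀ y ∈ F, ∀ z ∈ P, ∀ h : z - y ∈ MR n, 0 ≤ pairing n ξ ⟨z - y, h⟩}
  add_mem' := by
    intro a b ha hb y hy z hz h
    have h1 := ha y hy z hz h
    have h2 := hb y hy z hz h
    simp only [map_add, LinearMap.add_apply]
    exact add_nonneg h1 h2
  zero_mem' := by
    intro y hy z hz h
    simp
  smul_mem' := by
    intro c a ha y hy z hz h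
    have h1 := ha y hy z hz h
    have h2 : pairing n (c • a) ⟨z - y, h⟩ = (c : ℝ) * pairing n a ⟨z - y, h⟩ := by
      rw [← smul_eq_mul, ← LinearMap.smul_apply, ← map_smul]
      rfl
    rw [h2]
    exact mul_nonneg c.2 h1

/-- The (inner) normal fan in `N ⊗ ℝ` of a polytope `P`: the set of the normal cones of the
nonempty faces of `P` (including `P` itself). A face is the set of points at which some linear
functional attains its maximum over `P`. -/
def normalFan {n : ℕ} (P : Set (Fin (n + 1) → ℝ)) : Set (PointedCone ℝ (NR n)) :=
  {σ | ∃ F : Set (Fin (n + 1) → ℝ), F.Nonempty ∧ IsExposed ℝ P F ∧ σ = normalCone P F}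

/-! ## Triangulations of a polygon and their fans -/

/-- A triangulation of the convex `(n+2)`-gon with vertices `0, 1, ..., n+1` in counterclockwise
order, given as the set of its edges (the boundary edges of the polygon and the diagonals used).
An edge `{a, b}` with `a < b` is the pair `(a, b)`. There are `n - 1` diagonals, hence `2 n + 1`
edges (for `n = 0` the polygon degenerates to the single edge `{0, 1}`). -/
@[ext]
structure Triangulation (n : ℕ) where
  edges : Finset (ℕ × ℕ)
  lt_and_le : ∀ a b, (a, b) ∈ edges → a < b ∧ b ≤ n + 1
  side_mem : ∀ a ≤ n, (a, a + 1) ∈ edges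
  distinguished_mem : (0, n + 1) ∈ edges
  noncrossing : ∀ a b c d, (a, b) ∈ edges → (c, d) ∈ edges → ¬ (a < c ∧ c < b ∧ b < d)
  card_edges : edges.card = 2 * n + 1

namespace Triangulation

variable {n : ℕ}

/-- `a < k < b` are the vertices of a triangle of `T`. -/
def IsTriangle (T : Triangulation n) (a k b : ℕ) : Prop :=
  a < k ∧ k < b ∧ (a, k) ∈ T.edges ∧ (k, b) ∈ T.edges ∧ (a, b) ∈ T.edges

/-- The edges `(a, b)` that occur as distinguished edge of a triangulated polygon on the vertices
`a, a + 1, ..., b` when one starts with the distinguished edge `(0, n+1)` and repeatedly removes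
the distinguished edge `(a, b)`: if `a < k < b` is the triangle at this edge, the remaining edges
`(a, k)` and `(k, b)` become the distinguished edges of the two remaining parts. -/
inductive IsDistinguished (T : Triangulation n) : ℕ → ℕ → Prop
  | base : IsDistinguished T 0 (n + 1)
  | left {a k b : ℕ} : IsDistinguished T a b → T.IsTriangle a k b → IsDistinguished T a k
  | right {a k b : ℕ} : IsDistinguished T a b → T.IsTriangle a k b → IsDistinguished T k b

/-- `{a, k}` is an edge of the left tree. -/
def IsLeftEdge (T : Triangulation n) (a k : ℕ) : Prop :=
  ∃ b, T.IsDistinguished a b ∧ T.IsTriangle a k b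

/-- `{k, b}` is an edge of the right tree. -/
def IsRightEdge (T : Triangulation n) (k b : ℕ) : Prop :=
  ∃ a, T.IsDistinguished a b ∧ T.IsTriangle a k b

end Triangulation

/-- `ϖ_i`, `0 ≤ i ≤ n + 1`: the image of `e_1 + ... + e_i` in `N`. -/
def varpi (n i : ℕ) : NR n :=
  toNR n fun j => if (j : ℕ) < i then 1 else 0

namespace Triangulation

variable {n : ℕ}

/-- `x` is the vector `v_k = ϖ_k - ϖ_b`, where `{k, b}` with `k < b` is the edge of the right tree
whose smaller vertex is `k`. -/
def IsV (T : Triangulation n) (k : ℕ) (x : NR n) : Prop :=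
  ∃ b, T.IsRightEdge k b ∧ x = varpi n k - varpi n b

/-- `x` is the vector `w_k = ϖ_a - ϖ_k`, where `{a, k}` with `a < k` is the edge of the left tree
whose larger vertex is `k`. -/
def IsW (T : Triangulation n) (k : ℕ) (x : NR n) : Prop :=
  ∃ a, T.IsLeftEdge a k ∧ x = varpi n a - varpi n k

/-- The set `{v_k, w_k | 1 ≤ k ≤ n}`. -/
def rays (T : Triangulation n) : Set (NR n) :=
  {x | ∃ k, 1 ≤ k ∧ k ≤ n ∧ (T.IsV k x ∨ T.IsW k x)}

/-- The fan `Σ_T`: the cones spanned by those subsets of `{v_k, w_k | 1 ≤ k ≤ n}` that contain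
`{v_i, w_i}` for no `i`. -/
def fan (T : Triangulation n) : Set (PointedCone ℝ (NR n)) :=
  {σ | ∃ Q : Set (NR n), Q ⊆ T.rays ∧
    (∀ i, 1 ≤ i → i ≤ n → ∀ v w, T.IsV i v → T.IsW i w → ¬ ({v, w} ⊆ Q)) ∧
    σ = PointedCone.hull ℝ Q}

end Triangulation

/-! ## Binary trees, triangulations, and the map `ψ` -/

/-- The binary tree of a sequence of numbers: the smallest entry is the root, the entries to its
left give the left subtree, the entries to its right give the right subtree. -/
def minTree (l : List ℕ) : BinaryTree Unit :=
  if h : l = [] then .nil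
  else
    .node () (minTree (l.take (l.minIdxOn id h))) (minTree (l.drop (l.minIdxOn id h + 1)))
termination_by l.length
decreasing_by
  · have := List.minIdxOn_lt_length (f := id) h
    simp only [List.length_take]
    omega
  · have := List.minIdxOn_lt_length (f := id) h
    simp only [List.length_drop]
    omega

theorem numNodes_minTree (l : List ℕ) : (minTree l).numNodes = l.length := by
  induction hn : l.length using Nat.strong_induction_on generalizing l with
  | _ m ih =>
    rw [minTree]
    split_ifs with h
    · subst h
      simpa using hn
    · have hlt := List.minIdxOn_lt_length (f := id) h
      rw [BinaryTree.numNodes, ih _ (by rw [List.length_take]; omega) _ rfl,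
        ih _ (by rw [List.length_drop]; omega) _ rfl, List.length_take, List.length_drop]
      omega

/-- The binary tree of a permutation `u`, from its one-line notation `u(1) u(2) ... u(n)`. -/
def permTree {n : ℕ} (u : Equiv.Perm (Fin n)) : BinaryTree Unit :=
  minTree (List.ofFn fun i => (u i : ℕ) + 1)

theorem numNodes_permTree {n : ℕ} (u : Equiv.Perm (Fin n)) : (permTree u).numNodes = n := by
  simp [permTree, numNodes_minTree]

/-- The binary tree `t` is obtained from the triangulated polygon on the vertices `a, ..., b`, with
distinguished edge `(a, b)`: a single edge gives the empty tree; otherwise the root is the triangle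
`a < k < b` at the distinguished edge, and the edges `(a, k)` and `(k, b)` give its left and right
subtrees. -/
inductive Triangulation.TreeAt {n : ℕ} (T : Triangulation n) : ℕ → ℕ → BinaryTree Unit → Prop
  | nil (a : ℕ) (h : a ≤ n) : TreeAt T a (a + 1) .nil
  | node {a k b : ℕ} {l r : BinaryTree Unit} (h : T.IsTriangle a k b) :
      TreeAt T a k l → TreeAt T k b r → TreeAt T a b (.node () l r)

/-- `t` is the binary tree `B_T` of the triangulation `T`. -/
def Triangulation.HasTree {n : ℕ} (T : Triangulation n) (t : BinaryTree Unit) : Prop :=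
  T.TreeAt 0 (n + 1) t

/-- The edges of the triangulation with binary tree `t` of the polygon with vertices
`a, a + 1, ..., a + t.numNodes + 1` and distinguished edge `(a, a + t.numNodes + 1)`. -/
def treeEdges : ℕ → BinaryTree Unit → Finset (ℕ × ℕ)
  | a, .nil => {(a, a + 1)}
  | a, .node _ l r =>
      insert (a, a + (l.numNodes + r.numNodes + 1) + 1)
        (treeEdges a l ∪ treeEdges (a + l.numNodes + 1) r)

theorem treeEdges_bounds (t : BinaryTree Unit) (a x y : ℕ) (h : (x, y) ∈ treeEdges a t) :
    a ≤ x ∧ x < y ∧ y ≤ a + t.numNodes + 1 := by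
  induction t generalizing a with
  | nil => simp [treeEdges] at h; simp; omega
  | node _ l r ihl ihr =>
    simp only [treeEdges, Finset.mem_insert, Finset.mem_union, Prod.mk.injEq] at h
    simp only [BinaryTree.numNodes]
    rcases h with h | h | h
    · omega
    · have := ihl _ h; omega
    · have := ihr _ h; omega

theorem treeEdges_side (t : BinaryTree Unit) (a x : ℕ) (h1 : a ≤ x)
    (h2 : x ≤ a + t.numNodes) : (x, x + 1) ∈ treeEdges a t := by
  induction t generalizing a with
  | nil => simp at h2; simp [treeEdges]; omega
  | node _ l r ihl ihr =>
    simp only [BinaryTree.numNodes] at h2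
    simp only [treeEdges, Finset.mem_insert, Finset.mem_union]
    rcases Nat.lt_or_ge (a + l.numNodes) x with h | h
    · exact Or.inr (Or.inr (ihr _ (by omega) (by omega)))
    · exact Or.inr (Or.inl (ihl _ h1 h))

theorem treeEdges_distinguished (t : BinaryTree Unit) (a : ℕ) :
    (a, a + t.numNodes + 1) ∈ treeEdges a t := by
  cases t <;> simp [treeEdges]

theorem treeEdges_noncrossing (t : BinaryTree Unit) (a x y z w : ℕ)
    (h : (x, y) ∈ treeEdges a t) (h' : (z, w) ∈ treeEdges a t) : ¬ (x < z ∧ z < y ∧ y < w) := by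
  induction t generalizing a with
  | nil => simp [treeEdges] at h h'; omega
  | node _ l r ihl ihr =>
    simp only [treeEdges, Finset.mem_insert, Finset.mem_union, Prod.mk.injEq] at h h'
    rcases h with h | h | h <;> rcases h' with h' | h' | h'
    · omega
    · have := treeEdges_bounds _ _ _ _ h'; omega
    · have := treeEdges_bounds _ _ _ _ h'; omega
    · have := treeEdges_bounds _ _ _ _ h; omega
    · exact ihl _ h h'
    · have := treeEdges_bounds _ _ _ _ h
      have := treeEdges_bounds _ _ _ _ h'
      omega
    · have := treeEdges_bounds _ _ _ _ h; omega
    · have := treeEdges_bounds _ _ _ _ h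
      have := treeEdges_bounds _ _ _ _ h'
      omega
    · exact ihr _ h h'

theorem card_treeEdges (t : BinaryTree Unit) (a : ℕ) :
    (treeEdges a t).card = 2 * t.numNodes + 1 := by
  induction t generalizing a with
  | nil => simp [treeEdges]
  | node _ l r ihl ihr =>
    rw [treeEdges, Finset.card_insert_of_notMem, Finset.card_union_of_disjoint, ihl, ihr]
    · simp only [BinaryTree.numNodes]; omega
    · rw [Finset.disjoint_left]
      rintro ⟨x, y⟩ h h'
      have := treeEdges_bounds _ _ _ _ h
      have := treeEdges_bounds _ _ _ _ h'
      omega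
    · rw [Finset.mem_union]
      rintro (h | h)
      · have := treeEdges_bounds _ _ _ _ h; omega
      · have := treeEdges_bounds _ _ _ _ h; omega

/-- The triangulation of the `(n+2)`-gon that corresponds to a binary tree with `n` vertices. -/
def treeTriangulation {n : ℕ} (t : BinaryTree Unit) (ht : t.numNodes = n) : Triangulation n where
  edges := treeEdges 0 t
  lt_and_le a b h := by have := treeEdges_bounds _ _ _ _ h; omega
  side_mem a h := treeEdges_side _ _ _ (by omega) (by omega)
  distinguished_mem := by simpa [ht] using treeEdges_distinguished t 0
  noncrossing a b c d h h' := treeEdges_noncrossing t 0 a b c d h h'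
  card_edges := by rw [card_treeEdges, ht]

theorem treeAt_of_subset {n : ℕ} (T : Triangulation n) (t : BinaryTree Unit) (a : ℕ)
    (h : treeEdges a t ⊆ T.edges) : T.TreeAt a (a + t.numNodes + 1) t := by
  induction t generalizing a with
  | nil =>
    have := T.lt_and_le a (a + 1) (h (by simp [treeEdges]))
    exact .nil a (by omega)
  | node _ l r ihl ihr =>
    simp only [treeEdges, Finset.insert_subset_iff, Finset.union_subset_iff] at h
    obtain ⟨h0, hl, hr⟩ := h
    have e : a + l.numNodes + 1 + r.numNodes + 1 = a + (l.numNodes + r.numNodes + 1) + 1 := by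
      omega
    have h2 := hr (treeEdges_distinguished r _)
    have h3 := ihr _ hr
    rw [e] at h2 h3
    rw [BinaryTree.numNodes]
    exact .node ⟨by omega, by omega, hl (treeEdges_distinguished l a), h2, h0⟩ (ihl _ hl) h3

theorem subset_of_treeAt {n : ℕ} {T : Triangulation n} {a b : ℕ} {t : BinaryTree Unit}
    (h : T.TreeAt a b t) : b = a + t.numNodes + 1 ∧ treeEdges a t ⊆ T.edges := by
  induction h with
  | nil a h => simpa [treeEdges] using T.side_mem a h
  | node h _ _ ihl ihr =>
    obtain ⟨rfl, hl⟩ := ihl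
    obtain ⟨rfl, hr⟩ := ihr
    refine ⟨by simp only [BinaryTree.numNodes]; omega, ?_⟩
    simp only [treeEdges, Finset.insert_subset_iff, Finset.union_subset_iff]
    refine ⟨?_, hl, hr⟩
    have := h.2.2.2.2
    convert this using 2
    omega

/-- The correspondence between triangulations and binary trees: `treeTriangulation t` is the unique
triangulation whose binary tree is `t`. -/
theorem hasTree_iff {n : ℕ} (T : Triangulation n) (t : BinaryTree Unit) (ht : t.numNodes = n) :
    T.HasTree t ↔ T = treeTriangulation t ht := by
  constructor
  · intro h
    have h1 := (subset_of_treeAt h).2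
    ext1
    exact (Finset.eq_of_subset_of_card_le h1 (by rw [T.card_edges, card_treeEdges, ht])).symm
  · rintro rfl
    have := treeAt_of_subset (treeTriangulation t ht) t 0 (Finset.Subset.refl _)
    simpa [Triangulation.HasTree, ht] using this

/-- The triangulation `ψ(u)` of the `(n+2)`-gon associated with a permutation `u` of `n` letters:
the triangulation whose binary tree is the binary tree of `u`. -/
def psi {n : ℕ} (u : Equiv.Perm (Fin n)) : Triangulation n :=
  treeTriangulation (permTree u) (numNodes_permTree u)

end CatalanFan

end

noncomputable section

open scoped Matrix

namespace CatalanFan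

/-! ## Reduced words and the exchange property -/

/-! Put a(0) = a(n+1) = 0 and a(k) = u(k) (`valueSeq`), and count positions and values from 0. Then
h(u) has the entries a(0), ..., a(n), and h(u)s(1,n) the same sequence shifted by one, a(1), ...,
a(n+1). By the rank criterion `bruhatLE_iff_rankLE`, z lies in the interval iff for all i and j the
number of entries ≥ j among the first i entries of z lies between those for a(0), ..., a(i-1) and
for a(1), ..., a(i).

Subtracting the lower bound at p from the upper bound at q, and summing over the thresholds j,
bounds the sum of z over the positions p, ..., q-1 by the sum of a(p), ..., a(q) without the
smallest of them (`sum_Ico_add_le`). Let L and R be the nearest positions to the left and right of k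
with smaller entries. The intervals from k to R and from L to k give two inequalities, whose inner
normals are v_k and w_k.

The sequence is cut recursively at its minimum, as in its binary tree. A block receives one extra
value m, below all its entries. At the minimum k of the block, m goes to one side and a(k) to the
other; the side with a(k) makes its inequality tight, the other side is strict. So every choice of
one inequality for each k is realised by a point of the polytope (`exists_vertex_perm`). The same
recursion writes every vector, modulo (1, ..., 1), as a nonnegative combination of one of v_k, w_k
for each k (`IsBasin.exists_combination`).

These two facts say that the polytope is combinatorially a cube, and they determine its normal fan
(`IsCubical.normalFan_eq`). It remains to see that the triangles of ψ(u) at distinguished edges are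
exactly the triples L < k < R (`isDistinguished_and_isTriangle_psi_iff`). -/

theorem simpleTransposition_mul_self {n : ℕ} (i : Fin n) :
    simpleTransposition i * simpleTransposition i = 1 :=
  Equiv.swap_mul_self _ _

theorem wordProd_cons {n : ℕ} (i : Fin n) (l : List (Fin n)) :
    wordProd (i :: l) = simpleTransposition i * wordProd l := by
  simp [wordProd]

theorem wordProd_append_singleton {n : ℕ} (l : List (Fin n)) (i : Fin n) :
    wordProd (l ++ [i]) = wordProd l * simpleTransposition i := by
  simp [wordProd]

/-- Left multiplication by a simple transposition reverses the order of two values only if these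
are the two values that it exchanges. -/
theorem simpleTransposition_reverse {n : ℕ} (i : Fin n) (x y : Fin (n + 1)) (hxy : x < y)
    (h : simpleTransposition i y < simpleTransposition i x) : x = i.castSucc ∧ y = i.succ := by
  simp only [simpleTransposition, Equiv.swap_apply_def] at h
  rw [Fin.lt_def] at hxy
  split_ifs at h <;> simp only [Fin.lt_def, Fin.ext_iff, Fin.val_castSucc, Fin.val_succ] at * <;>
    omega

/-- The exchange property: multiplying a word by a simple transposition at a descent amounts to
deleting a letter. -/
theorem exists_word_of_descent {n : ℕ} (i : Fin n) (l : List (Fin n))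
    (h : wordProd l i.succ < wordProd l i.castSucc) :
    ∃ l' : List (Fin n), wordProd l' = wordProd l * simpleTransposition i ∧
      l'.length + 1 = l.length := by
  induction l with
  | nil =>
    exfalso
    simp [wordProd, Fin.lt_def] at h
  | cons t l ih =>
    rcases lt_trichotomy (wordProd l i.succ) (wordProd l i.castSucc) with h1 | h1 | h1
    · obtain ⟨l', h2, h3⟩ := ih h1
      exact ⟨t :: l', by rw [wordProd_cons, wordProd_cons, h2, mul_assoc], by simp [h3]⟩
    · have := (wordProd l).injective h1
      simp [Fin.ext_iff] at this
    -- The suffix `l` ascends at `i` and the letter `t` undoes this, so `t` swaps the two values of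
    -- `l` at `i`. Hence `t` is the conjugate of `s_i` by `l`, and `t l s_i = l`: the letter to
    -- delete is `t`.
    · rw [wordProd_cons] at h
      obtain ⟨h2, h3⟩ := simpleTransposition_reverse t _ _ h1 h
      refine ⟨l, ?_, by simp⟩
      have h4 : simpleTransposition t = wordProd l * simpleTransposition i * (wordProd l)⁻¹ := by
        rw [simpleTransposition, ← h2, ← h3, simpleTransposition, Equiv.swap_apply_apply]
      rw [wordProd_cons, h4, inv_mul_cancel_right, mul_assoc, simpleTransposition_mul_self, mul_one]

theorem mul_simpleTransposition_castSucc {n : ℕ} (w : Equiv.Perm (Fin (n + 1))) (i : Fin n) :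
    (w * simpleTransposition i) i.castSucc = w i.succ := by
  simp [simpleTransposition]

theorem mul_simpleTransposition_succ {n : ℕ} (w : Equiv.Perm (Fin (n + 1))) (i : Fin n) :
    (w * simpleTransposition i) i.succ = w i.castSucc := by
  simp [simpleTransposition]

theorem apply_castSucc_ne_apply_succ {n : ℕ} (w : Equiv.Perm (Fin (n + 1))) (i : Fin n) :
    w i.castSucc ≠ w i.succ := fun h => by
  simpa [Fin.ext_iff] using w.injective h

theorem IsReducedWord.of_append_singleton {n : ℕ} {w : Equiv.Perm (Fin (n + 1))}
    {l : List (Fin n)} {i : Fin n} (h : IsReducedWord w (l ++ [i])) :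
    IsReducedWord (wordProd l) l ∧ wordProd l i.castSucc < wordProd l i.succ := by
  obtain ⟨h1, h2⟩ := h
  rw [wordProd_append_singleton] at h1
  refine ⟨⟨rfl, fun l' hl' => ?_⟩, ?_⟩
  · have := h2 (l' ++ [i]) (by rw [wordProd_append_singleton, hl', h1])
    simpa using this
  · by_contra h3
    obtain ⟨l', h4, h5⟩ := exists_word_of_descent i l
      (lt_of_le_of_ne (not_lt.mp h3) (apply_castSucc_ne_apply_succ _ _).symm)
    have := h2 l' (h4.trans h1)
    simp at this
    omega

/-- Any word for `w s_i` ends in a permutation with a descent at `i`, so the exchange property turns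
it into a word for `w` with one letter less. -/
theorem IsReducedWord.append_singleton {n : ℕ} {w : Equiv.Perm (Fin (n + 1))}
    {l : List (Fin n)} {i : Fin n} (h : IsReducedWord w l) (hi : w i.castSucc < w i.succ) :
    IsReducedWord (w * simpleTransposition i) (l ++ [i]) := by
  refine ⟨by rw [wordProd_append_singleton, h.1], fun l' hl' => ?_⟩
  obtain ⟨l'', h1, h2⟩ := exists_word_of_descent i l' (by
    rwa [hl', mul_simpleTransposition_castSucc, mul_simpleTransposition_succ])
  rw [hl', mul_assoc, simpleTransposition_mul_self, mul_one] at h1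
  have := h.2 l'' h1
  simp
  omega

theorem exists_isReducedWord {n : ℕ} (w : Equiv.Perm (Fin (n + 1))) :
    ∃ l, IsReducedWord w l := by
  classical
  have hw : ∃ l : List (Fin n), wordProd l = w := by
    have h : w ∈ Submonoid.closure
        (Set.range fun i : Fin n => Equiv.swap i.castSucc i.succ) := by
      rw [Equiv.Perm.mclosure_swap_castSucc_succ]
      trivial
    induction h using Submonoid.closure_induction with
    | mem x hx =>
      obtain ⟨i, rfl⟩ := hx
      exact ⟨[i], by simp [wordProd, simpleTransposition]⟩
    | one => exact ⟨[], by simp [wordProd]⟩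
    | mul x y _ _ hx hy =>
      obtain ⟨l, rfl⟩ := hx
      obtain ⟨l', rfl⟩ := hy
      exact ⟨l ++ l', by simp [wordProd]⟩
  have h : ∃ m, ∃ l : List (Fin n), wordProd l = w ∧ l.length = m := by
    obtain ⟨l, hl⟩ := hw
    exact ⟨_, l, hl, rfl⟩
  obtain ⟨l, hl, hm⟩ := Nat.find_spec h
  exact ⟨l, hl, fun l' hl' => hm ▸ Nat.find_min' h ⟨l', hl', rfl⟩⟩

/-! ## The rank criterion for the Bruhat order -/

/-- The number of entries `≥ j` among the first `i` entries of the one-line notation. -/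
def prefixCount {n : ℕ} (z : Equiv.Perm (Fin (n + 1))) (i j : ℕ) : ℕ :=
  ∑ x : Fin (n + 1), if (x : ℕ) < i ∧ j ≤ (z x : ℕ) then 1 else 0

theorem prefixCount_zero {n : ℕ} (z : Equiv.Perm (Fin (n + 1))) (j : ℕ) :
    prefixCount z 0 j = 0 := by
  simp [prefixCount]

theorem prefixCount_succ {n : ℕ} (z : Equiv.Perm (Fin (n + 1))) (i : Fin (n + 1)) (j : ℕ) :
    prefixCount z ((i : ℕ) + 1) j = prefixCount z i j + if j ≤ (z i : ℕ) then 1 else 0 := by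
  have h : (if j ≤ (z i : ℕ) then 1 else 0) =
      ∑ x : Fin (n + 1), if x = i then (if j ≤ (z x : ℕ) then 1 else 0) else 0 := by
    simp
  rw [h, prefixCount, prefixCount, ← Finset.sum_add_distrib]
  refine Finset.sum_congr rfl fun x _ => ?_
  rcases lt_trichotomy x i with hx | rfl | hx
  · have := Fin.lt_def.mp hx
    simp [hx.ne, this, Nat.lt_succ_of_lt this]
  · simp
  · have := Fin.lt_def.mp hx
    simp [hx.ne', show ¬ ((x : ℕ) < i + 1) by omega, show ¬ ((x : ℕ) < i) by omega]

theorem prefixCount_of_le {n : ℕ} (z : Equiv.Perm (Fin (n + 1))) {i : ℕ} (j : ℕ)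
    (hi : n + 1 ≤ i) : prefixCount z i j = ∑ y : Fin (n + 1), if j ≤ (y : ℕ) then 1 else 0 := by
  rw [← Equiv.sum_comp z, prefixCount]
  refine Finset.sum_congr rfl fun x _ => ?_
  simp [show (x : ℕ) < i by omega]

theorem prefixCount_mul_of_ne {n : ℕ} (z : Equiv.Perm (Fin (n + 1))) (s : Fin n) {i : ℕ} (j : ℕ)
    (hi : i ≠ (s : ℕ) + 1) :
    prefixCount (z * simpleTransposition s) i j = prefixCount z i j := by
  rw [prefixCount, prefixCount, ← Equiv.sum_comp (simpleTransposition s)]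
  refine Finset.sum_congr rfl fun x _ => ?_
  have h1 : (z * simpleTransposition s) (simpleTransposition s x) = z x := by
    simp [simpleTransposition]
  have h2 : ((simpleTransposition s x : Fin (n + 1)) : ℕ) < i ↔ (x : ℕ) < i := by
    simp only [simpleTransposition, Equiv.swap_apply_def]
    split_ifs with h h' <;> simp_all <;> omega
  simp only [h1, h2]

/-- The comparison of all the numbers `prefixCount`. -/
def RankLE {n : ℕ} (v w : Equiv.Perm (Fin (n + 1))) : Prop :=
  ∀ i j, prefixCount v i j ≤ prefixCount w i j

theorem prefixCount_castSucc_add_one {n : ℕ} (z : Equiv.Perm (Fin (n + 1))) (s : Fin n) (j : ℕ) :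
    prefixCount z ((s : ℕ) + 1) j =
      prefixCount z s j + if j ≤ (z s.castSucc : ℕ) then 1 else 0 := by
  simpa using prefixCount_succ z s.castSucc j

theorem prefixCount_succ_add_one {n : ℕ} (z : Equiv.Perm (Fin (n + 1))) (s : Fin n) (j : ℕ) :
    prefixCount z ((s : ℕ) + 2) j =
      prefixCount z ((s : ℕ) + 1) j + if j ≤ (z s.succ : ℕ) then 1 else 0 := by
  simpa using prefixCount_succ z s.succ j

theorem prefixCount_mul_self {n : ℕ} (z : Equiv.Perm (Fin (n + 1))) (s : Fin n) (j : ℕ) :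
    prefixCount (z * simpleTransposition s) ((s : ℕ) + 1) j =
      prefixCount z s j + if j ≤ (z s.succ : ℕ) then 1 else 0 := by
  rw [prefixCount_castSucc_add_one, mul_simpleTransposition_castSucc,
    prefixCount_mul_of_ne _ _ _ (by omega)]

/-- Only the prefix of length `s + 1` notices the swap. There, either the larger entry of `w` is
counted and the comparison at length `s` suffices, or neither entry of `w` is counted and the
comparison at length `s + 2` does. -/
theorem RankLE.mul_right {n : ℕ} {v w : Equiv.Perm (Fin (n + 1))} {s : Fin n}
    (h : RankLE v w) (hs : w s.castSucc < w s.succ) :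
    RankLE (v * simpleTransposition s) (w * simpleTransposition s) := by
  intro i j
  by_cases hi : i = (s : ℕ) + 1
  · subst hi
    rw [prefixCount_mul_self, prefixCount_mul_self]
    have h0 := h s j
    have h2 := h (s + 2) j
    rw [prefixCount_succ_add_one, prefixCount_succ_add_one, prefixCount_castSucc_add_one,
      prefixCount_castSucc_add_one] at h2
    rw [Fin.lt_def] at hs
    split_ifs at h2 ⊢ <;> omega
  · rw [prefixCount_mul_of_ne _ _ _ hi, prefixCount_mul_of_ne _ _ _ hi]
    exact h i j

theorem rankLE_mul_right_self {n : ℕ} {w : Equiv.Perm (Fin (n + 1))} {s : Fin n}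
    (hs : w s.castSucc < w s.succ) : RankLE w (w * simpleTransposition s) := by
  intro i j
  by_cases hi : i = (s : ℕ) + 1
  · subst hi
    rw [prefixCount_mul_self, prefixCount_castSucc_add_one]
    rw [Fin.lt_def] at hs
    split_ifs <;> omega
  · rw [prefixCount_mul_of_ne _ _ _ hi]

/-- If `v` and `w` ascend at `s`, then `v ≤ w s` or `v s ≤ w s` imply `v ≤ w`. -/
theorem RankLE.of_ascents {n : ℕ} {v x w : Equiv.Perm (Fin (n + 1))} {s : Fin n}
    (h : RankLE x (w * simpleTransposition s)) (hx : x = v ∨ x = v * simpleTransposition s)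
    (hv : v s.castSucc < v s.succ) : RankLE v w := by
  have h' : ∀ i j, i ≠ (s : ℕ) + 1 → prefixCount v i j ≤ prefixCount w i j := by
    intro i j hi
    have := h i j
    rw [prefixCount_mul_of_ne _ _ _ hi] at this
    rcases hx with rfl | rfl
    · exact this
    · rwa [prefixCount_mul_of_ne _ _ _ hi] at this
  intro i j
  by_cases hi : i = (s : ℕ) + 1
  · subst hi
    -- If `v s < j`, length `s` suffices. Otherwise the ascent makes both swapped entries of `v`
    -- count, and length `s + 2` gives the claim after dropping one entry on each side.
    have h0 := h' s j (by omega)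
    have h2 := h' (s + 2) j (by omega)
    rw [prefixCount_succ_add_one, prefixCount_succ_add_one, prefixCount_castSucc_add_one,
      prefixCount_castSucc_add_one] at h2
    rw [prefixCount_castSucc_add_one, prefixCount_castSucc_add_one]
    rw [Fin.lt_def] at hv
    split_ifs at h2 ⊢ <;> omega
  · exact h' i j hi

theorem RankLE.refl {n : ℕ} (w : Equiv.Perm (Fin (n + 1))) : RankLE w w := fun _ _ => le_rfl

theorem RankLE.trans {n : ℕ} {v w x : Equiv.Perm (Fin (n + 1))} (h : RankLE v w)
    (h' : RankLE w x) : RankLE v x := fun i j => (h i j).trans (h' i j)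

/-- The first `x + 1` entries of the identity contain nothing above `x`, which forces `v x ≤ x`; a
permutation with this property is the identity. -/
theorem RankLE.eq_one {n : ℕ} {v : Equiv.Perm (Fin (n + 1))} (h : RankLE v 1) : v = 1 := by
  have h1 : ∀ x, v x ≤ x := by
    intro x
    by_contra hx
    rw [not_le, Fin.lt_def] at hx
    have h2 := h (x + 1) (x + 1)
    have h3 : prefixCount (1 : Equiv.Perm (Fin (n + 1))) (x + 1) (x + 1) = 0 := by
      simp [prefixCount]
    rw [h3, prefixCount_succ, if_pos (by omega)] at h2
    omega
  ext x
  induction hx : (x : ℕ) using Nat.strong_induction_on generalizing x with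
  | _ m ih =>
    rcases (h1 x).lt_or_eq with h2 | h2
    · have h3 := ih (v x) (by rw [← hx]; exact h2) (v x) rfl
      have h4 : v (v x) = v x := Fin.ext h3
      exact absurd (v.injective h4) h2.ne
    · rw [h2]
      simp [hx]

theorem rankLE_of_sublist {n : ℕ} (l l' : List (Fin n)) (h : l'.Sublist l)
    (hl : IsReducedWord (wordProd l) l) : RankLE (wordProd l') (wordProd l) := by
  induction l using List.reverseRecOn generalizing l' with
  | nil => rw [List.sublist_nil.mp h]; exact .refl _
  | append_singleton l i ih =>
    obtain ⟨h1, h2⟩ := hl.of_append_singleton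
    obtain ⟨l1, l2, rfl, h3, h4⟩ := List.sublist_append_iff.mp h
    have h5 := ih l1 h3 h1
    rcases List.sublist_singleton.mp h4 with rfl | rfl
    · rw [List.append_nil, wordProd_append_singleton]
      exact h5.trans (rankLE_mul_right_self h2)
    · rw [wordProd_append_singleton, wordProd_append_singleton]
      exact h5.mul_right h2

theorem RankLE.bruhatLE {n : ℕ} {v w : Equiv.Perm (Fin (n + 1))} (h : RankLE v w) :
    BruhatLE v w := by
  -- The induction needs the stronger form in which the reduced word of `w` is prescribed. Its last
  -- letter `s` is removed, and is put back for `v` exactly when `v` descends at `s`.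
  suffices H : ∀ (l : List (Fin n)) (v w : Equiv.Perm (Fin (n + 1))), IsReducedWord w l →
      RankLE v w → ∃ lv : List (Fin n), IsReducedWord v lv ∧ lv.Sublist l by
    obtain ⟨l, hl⟩ := exists_isReducedWord w
    obtain ⟨lv, h1, h2⟩ := H l v w hl h
    exact ⟨lv, l, h1, hl, h2⟩
  intro l
  induction l using List.reverseRecOn with
  | nil =>
    intro v w hl h
    have hw : w = 1 := by rw [← hl.1]; simp [wordProd]
    subst hw
    rw [h.eq_one]
    exact ⟨[], hl, List.Sublist.refl _⟩
  | append_singleton l s ih =>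
    intro v w hl h
    obtain ⟨h1, h2⟩ := hl.of_append_singleton
    have h3 := hl.1
    rw [wordProd_append_singleton] at h3
    subst h3
    rcases lt_or_gt_of_ne (apply_castSucc_ne_apply_succ v s) with hv | hv
    · obtain ⟨lv, h4, h5⟩ := ih v _ h1 (h.of_ascents (Or.inl rfl) hv)
      exact ⟨lv, h4, h5.trans (List.sublist_append_left _ _)⟩
    · have e : v = v * simpleTransposition s * simpleTransposition s := by
        rw [mul_assoc, simpleTransposition_mul_self, mul_one]
      have hv' : (v * simpleTransposition s) s.castSucc < (v * simpleTransposition s) s.succ := by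
        rwa [mul_simpleTransposition_castSucc, mul_simpleTransposition_succ]
      obtain ⟨lv, h4, h5⟩ := ih (v * simpleTransposition s) _ h1
        (h.of_ascents (Or.inr e) hv')
      refine ⟨lv ++ [s], ?_, h5.append (List.Sublist.refl _)⟩
      rw [e]
      exact h4.append_singleton hv'

theorem bruhatLE_iff_rankLE {n : ℕ} {v w : Equiv.Perm (Fin (n + 1))} :
    BruhatLE v w ↔ RankLE v w := by
  refine ⟨?_, RankLE.bruhatLE⟩
  rintro ⟨lv, lw, hv, hw, h⟩
  have h1 := hw.1
  have h2 := hv.1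
  subst h1 h2
  exact rankLE_of_sublist _ _ h hw

/-! ## Basins and nodes of a sequence -/

/-- All entries strictly between the positions `p` and `q` exceed the entries at `p` and `q`. -/
def IsBasin (a : ℕ → ℕ) (p q : ℕ) : Prop :=
  p < q ∧ ∀ t, p < t → t < q → a p < a t ∧ a q < a t

/-- `p` and `q` are the nearest positions to the left and to the right of `k` with entries smaller
than that at `k`. -/
def IsNode (a : ℕ → ℕ) (p k q : ℕ) : Prop :=
  p < k ∧ k < q ∧ a p < a k ∧ a q < a k ∧ ∀ t, p < t → t < q → t ≠ k → a k < a t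

theorem IsNode.unique {a : ℕ → ℕ} {p k q p' q' : ℕ} (h : IsNode a p k q)
    (h' : IsNode a p' k q') : p = p' ∧ q = q' := by
  obtain ⟨h1, h2, h3, h4, h5⟩ := h
  obtain ⟨h1', h2', h3', h4', h5'⟩ := h'
  constructor
  · rcases lt_trichotomy p p' with h | h | h
    · have := h5 p' h (by omega) (by omega); omega
    · exact h
    · have := h5' p h (by omega) (by omega); omega
  · rcases lt_trichotomy q q' with h | h | h
    · have := h5' q (by omega) h (by omega); omega
    · exact h
    · have := h5 q' (by omega) h (by omega); omega

theorem IsNode.isBasin_left {a : ℕ → ℕ} {p k q : ℕ} (h : IsNode a p k q) : IsBasin a p k := by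
  obtain ⟨h1, h2, h3, h4, h5⟩ := h
  refine ⟨h1, fun t ht ht' => ?_⟩
  have := h5 t ht (by omega) (by omega)
  omega

theorem IsNode.isBasin_right {a : ℕ → ℕ} {p k q : ℕ} (h : IsNode a p k q) : IsBasin a k q := by
  obtain ⟨h1, h2, h3, h4, h5⟩ := h
  refine ⟨h2, fun t ht ht' => ?_⟩
  have := h5 t (by omega) (by omega) (by omega)
  omega

/-- A node inside the interval of another node is this node or lies to one side of it. -/
theorem IsNode.cases_of_le {a : ℕ → ℕ} {p k q p' k' q' : ℕ} (h : IsNode a p k q)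
    (h' : IsNode a p' k' q') (hp : p ≤ p') (hq : q' ≤ q) :
    (p' = p ∧ k' = k ∧ q' = q) ∨ q' ≤ k ∨ k ≤ p' := by
  rcases eq_or_ne k' k with rfl | hk
  · have := h.unique h'
    omega
  · right
    by_contra hc
    obtain ⟨h1, h2, h3, h4, h5⟩ := h
    obtain ⟨h1', h2', h3', h4', h5'⟩ := h'
    have := h5 k' (by omega) (by omega) hk
    have := h5' k (by omega) (by omega) hk.symm
    omega

theorem IsBasin.exists_isNode {a : ℕ → ℕ} {p q : ℕ} (h : IsBasin a p q) (hpq : p + 1 < q)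
    (ha : Set.InjOn a (Set.Ioo p q)) : ∃ k, IsNode a p k q := by
  obtain ⟨k, hk, hmin⟩ := Finset.exists_min_image (Finset.Ioo p q) a ⟨p + 1, by simp; omega⟩
  rw [Finset.mem_Ioo] at hk
  refine ⟨k, hk.1, hk.2, (h.2 k hk.1 hk.2).1, (h.2 k hk.1 hk.2).2, fun t ht ht' hne => ?_⟩
  exact lt_of_le_of_ne (hmin t (by simp; omega)) fun he => hne (ha ⟨ht, ht'⟩ hk he.symm)

/-- Induction over basins by splitting at the position of the smallest entry. -/
theorem IsBasin.induction {a : ℕ → ℕ} {motive : ℕ → ℕ → Prop}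
    (edge : ∀ p, motive p (p + 1))
    (node : ∀ p k q, IsNode a p k q → motive p k → motive k q → motive p q)
    {p q : ℕ} (h : IsBasin a p q) (ha : Set.InjOn a (Set.Ioo p q)) : motive p q := by
  induction hd : q - p using Nat.strong_induction_on generalizing p q with
  | _ d ih =>
    have hpq := h.1
    rcases Nat.lt_or_ge (p + 1) q with hlt | hge
    · obtain ⟨k, hk⟩ := h.exists_isNode hlt ha
      have h1 := hk.1
      have h2 := hk.2.1
      exact node p k q hk
        (ih (k - p) (by omega) hk.isBasin_left (ha.mono (Set.Ioo_subset_Ioo_right h2.le)) rfl)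
        (ih (q - k) (by omega) hk.isBasin_right (ha.mono (Set.Ioo_subset_Ioo_left h1.le)) rfl)
    · obtain rfl : q = p + 1 := by omega
      exact edge p

theorem IsBasin.exists_isNode_at {a : ℕ → ℕ} {p q : ℕ} (h : IsBasin a p q)
    (ha : Set.InjOn a (Set.Ioo p q)) : ∀ k, p < k → k < q →
      ∃ p' q', p ≤ p' ∧ q' ≤ q ∧ IsNode a p' k q' := by
  refine IsBasin.induction (a := a) (motive := fun p q => ∀ k, p < k → k < q →
      ∃ p' q', p ≤ p' ∧ q' ≤ q ∧ IsNode a p' k q') ?_ ?_ h ha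
  · intro p k h1 h2
    omega
  · intro p r q hr hl hR k h1 h2
    have := hr.1
    have := hr.2.1
    rcases lt_trichotomy k r with hk | rfl | hk
    · obtain ⟨p', q', h3, h4, h5⟩ := hl k h1 hk
      exact ⟨p', q', h3, by omega, h5⟩
    · exact ⟨p, q, le_rfl, le_rfl, hr⟩
    · obtain ⟨p', q', h3, h4, h5⟩ := hR k hk h2
      exact ⟨p', q', by omega, h4, h5⟩

theorem sum_Ico_eq_add_sum_Ioo (f : ℕ → ℕ) {p q : ℕ} (h : p < q) :
    ∑ i ∈ Finset.Ico p q, f i = f p + ∑ i ∈ Finset.Ioo p q, f i := by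
  rw [← Finset.Ioo_insert_left h, Finset.sum_insert (by simp)]

theorem sum_Ioc_eq_sum_Ioo_add (f : ℕ → ℕ) {p q : ℕ} (h : p < q) :
    ∑ i ∈ Finset.Ioc p q, f i = ∑ i ∈ Finset.Ioo p q, f i + f q := by
  rw [← Finset.Ioo_insert_right h, Finset.sum_insert (by simp), add_comm]

theorem sum_Ioo_split {M : Type*} [AddCommMonoid M] (f : ℕ → M) {p k q : ℕ} (h : p < k)
    (h' : k < q) : ∑ i ∈ Finset.Ioo p q, f i =
      ∑ i ∈ Finset.Ioo p k, f i + f k + ∑ i ∈ Finset.Ioo k q, f i := by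
  have e : Finset.Ioo p q = Finset.Ioo p k ∪ insert k (Finset.Ioo k q) := by
    ext i; simp; omega
  rw [e, Finset.sum_union, Finset.sum_insert (by simp), add_assoc]
  rw [Finset.disjoint_left]
  intro i
  simp
  omega

theorem sum_Ioc_split (f : ℕ → ℕ) {p k i : ℕ} (h : p < k) (h' : k ≤ i) :
    ∑ t ∈ Finset.Ioc p i, f t =
      ∑ t ∈ Finset.Ioo p k, f t + f k + ∑ t ∈ Finset.Ioc k i, f t := by
  rw [← sum_Ioc_eq_sum_Ioo_add f h]
  have e : Finset.Ioc p i = Finset.Ioc p k ∪ Finset.Ioc k i := by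
    ext i; simp; omega
  rw [e, Finset.sum_union]
  rw [Finset.disjoint_left]
  intro i
  simp
  omega

/-- The sequences of values of the vertices of the polytope: at the node `p, k, q`, the smallest
available value `m` goes to the left and `a k` to the right if `ε k`, and conversely otherwise. The
second property compares the first entries with those of the bottom and the top of the interval. -/
theorem IsBasin.exists_values {a : ℕ → ℕ} {p q : ℕ} (h : IsBasin a p q)
    (ha : Set.InjOn a (Set.Ioo p q)) (ε : ℕ → Bool) : ∀ m, (∀ t, p < t → t < q → m < a t) →
    ∃ z : ℕ → ℕ,
      (∀ f : ℕ → ℕ, ∑ i ∈ Finset.Ico p q, f (z i) = f m + ∑ t ∈ Finset.Ioo p q, f (a t)) ∧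
      (∀ f : ℕ → ℕ, Monotone f → ∀ i, p < i → i < q →
        f m + ∑ t ∈ Finset.Ioo p i, f (a t) ≤ ∑ t ∈ Finset.Ico p i, f (z t) ∧
        ∑ t ∈ Finset.Ico p i, f (z t) ≤ ∑ t ∈ Finset.Ioc p i, f (a t)) ∧
      ∀ p' k' q', p ≤ p' → q' ≤ q → IsNode a p' k' q' →
        (ε k' = true → ∑ i ∈ Finset.Ico k' q', z i = ∑ i ∈ Finset.Ico k' q', a i ∧
          ∑ i ∈ Finset.Ico p' k', z i < ∑ i ∈ Finset.Ioc p' k', a i) ∧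
        (ε k' = false → ∑ i ∈ Finset.Ico p' k', z i = ∑ i ∈ Finset.Ioc p' k', a i ∧
          ∑ i ∈ Finset.Ico k' q', z i < ∑ i ∈ Finset.Ico k' q', a i) := by
  refine IsBasin.induction (a := a) (motive := fun p q => ∀ m, (∀ t, p < t → t < q → m < a t) →
    ∃ z : ℕ → ℕ,
      (∀ f : ℕ → ℕ, ∑ i ∈ Finset.Ico p q, f (z i) = f m + ∑ t ∈ Finset.Ioo p q, f (a t)) ∧
      (∀ f : ℕ → ℕ, Monotone f → ∀ i, p < i → i < q →
        f m + ∑ t ∈ Finset.Ioo p i, f (a t) ≤ ∑ t ∈ Finset.Ico p i, f (z t) ∧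
        ∑ t ∈ Finset.Ico p i, f (z t) ≤ ∑ t ∈ Finset.Ioc p i, f (a t)) ∧
      ∀ p' k' q', p ≤ p' → q' ≤ q → IsNode a p' k' q' →
        (ε k' = true → ∑ i ∈ Finset.Ico k' q', z i = ∑ i ∈ Finset.Ico k' q', a i ∧
          ∑ i ∈ Finset.Ico p' k', z i < ∑ i ∈ Finset.Ioc p' k', a i) ∧
        (ε k' = false → ∑ i ∈ Finset.Ico p' k', z i = ∑ i ∈ Finset.Ioc p' k', a i ∧
          ∑ i ∈ Finset.Ico k' q', z i < ∑ i ∈ Finset.Ico k' q', a i)) ?_ ?_ h ha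
  · intro p m _
    refine ⟨fun _ => m, fun f => by simp, fun f _ i h1 h2 => by omega, ?_⟩
    intro p' k' q' h1 h2 h3
    have := h3.1
    have := h3.2.1
    omega
  · intro p k q hk hl hr m hm
    have hpk := hk.1
    have hkq := hk.2.1
    have hmk : m < a k := hm k hpk hkq
    -- Both `m` and `a k` lie below all other entries of the block, so each may serve as the extra
    -- value of either side.
    obtain ⟨z1, h11, h12, h13⟩ := hl (if ε k then m else a k) (by
      intro t h1 h2
      have := hm t h1 (by omega)
      have := hk.2.2.2.2 t h1 (by omega) (by omega)
      split_ifs <;> omega)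
    obtain ⟨z2, h21, h22, h23⟩ := hr (if ε k then a k else m) (by
      intro t h1 h2
      have := hm t (by omega) h2
      have := hk.2.2.2.2 t (by omega) h2 (by omega)
      split_ifs <;> omega)
    have hz1 : ∀ (f : ℕ → ℕ) x y, y ≤ k →
        ∑ i ∈ Finset.Ico x y, f (if i < k then z1 i else z2 i) =
          ∑ i ∈ Finset.Ico x y, f (z1 i) := by
      intro f x y hy
      refine Finset.sum_congr rfl fun i hi => ?_
      rw [Finset.mem_Ico] at hi
      rw [if_pos (by omega)]
    have hz2 : ∀ (f : ℕ → ℕ) x y, k ≤ x →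
        ∑ i ∈ Finset.Ico x y, f (if i < k then z1 i else z2 i) =
          ∑ i ∈ Finset.Ico x y, f (z2 i) := by
      intro f x y hy
      refine Finset.sum_congr rfl fun i hi => ?_
      rw [Finset.mem_Ico] at hi
      rw [if_neg (by omega)]
    refine ⟨fun i => if i < k then z1 i else z2 i, fun f => ?_, fun f hf i hi hi' => ?_, ?_⟩
    · rw [← Finset.sum_Ico_consecutive _ hpk.le hkq.le, hz1 f _ _ le_rfl, hz2 f _ _ le_rfl, h11,
        h21, sum_Ioo_split (fun t => f (a t)) hpk hkq]
      split_ifs <;> ring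
    · have hm1 : f m ≤ f (if ε k then m else a k) := hf (by split_ifs <;> omega)
      have hm2 : f (if ε k then m else a k) ≤ f (a k) := hf (by split_ifs <;> omega)
      have hm3 : f (if ε k then m else a k) + f (if ε k then a k else m) = f m + f (a k) := by
        split_ifs <;> ring
      rcases lt_trichotomy i k with hik | rfl | hik
      · have := h12 f hf i hi hik
        rw [hz1 f _ _ hik.le]
        omega
      · rw [hz1 f _ _ le_rfl, h11, sum_Ioc_eq_sum_Ioo_add (fun t => f (a t)) hpk]
        omega
      · have := h22 f hf i hik hi'
        rw [← Finset.sum_Ico_consecutive _ hpk.le hik.le, hz1 f _ _ le_rfl, hz2 f _ _ le_rfl, h11,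
          sum_Ioc_split (fun t => f (a t)) hpk hik.le, sum_Ioo_split (fun t => f (a t)) hpk hik]
        omega
    · intro p' k' q' hp' hq' h'
      have := h'.1
      have := h'.2.1
      dsimp only
      rcases hk.cases_of_le h' hp' hq' with ⟨rfl, rfl, rfl⟩ | hc | hc
      · rw [hz1 (fun x => x) _ _ le_rfl, hz2 (fun x => x) _ _ le_rfl, h11 (fun x => x),
          h21 (fun x => x), sum_Ioc_eq_sum_Ioo_add a hpk, sum_Ico_eq_add_sum_Ioo a hkq]
        constructor <;> intro hε <;> simp [hε] <;> omega
      · rw [hz1 (fun x => x) _ _ hc, hz1 (fun x => x) p' k' (by omega)]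
        exact h13 p' k' q' hp' hc h'
      · rw [hz2 (fun x => x) _ _ hc, hz2 (fun x => x) k' q' (by omega)]
        exact h23 p' k' q' hc hq' h'

/-- A sequence supported on a basin is a combination of the constant sequence and, for each node,
of one of the indicators of the two intervals that it cuts off. -/
theorem IsBasin.exists_combination {a : ℕ → ℕ} {p q : ℕ} (h : IsBasin a p q)
    (ha : Set.InjOn a (Set.Ioo p q)) (L R : ℕ → ℕ)
    (hLR : ∀ k, p < k → k < q → IsNode a (L k) k (R k)) (x : ℕ → ℝ) : ∃ (d : ℝ) (c : ℕ → ℝ),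
      ∀ i, p ≤ i → i < q → x i = d - ∑ k ∈ Finset.Ioo p q,
        (max (c k) 0 * (if k ≤ i ∧ i < R k then 1 else 0) +
          max (-c k) 0 * (if L k ≤ i ∧ i < k then 1 else 0)) := by
  suffices H : (∀ k, p < k → k < q → IsNode a (L k) k (R k)) → ∃ (d : ℝ) (c : ℕ → ℝ),
      ∀ i, p ≤ i → i < q → x i = d - ∑ k ∈ Finset.Ioo p q,
        (max (c k) 0 * (if k ≤ i ∧ i < R k then 1 else 0) +
          max (-c k) 0 * (if L k ≤ i ∧ i < k then 1 else 0)) from H hLR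
  clear hLR
  refine IsBasin.induction (a := a) (motive := fun p q =>
    (∀ k, p < k → k < q → IsNode a (L k) k (R k)) → ∃ (d : ℝ) (c : ℕ → ℝ),
      ∀ i, p ≤ i → i < q → x i = d - ∑ k ∈ Finset.Ioo p q,
        (max (c k) 0 * (if k ≤ i ∧ i < R k then 1 else 0) +
          max (-c k) 0 * (if L k ≤ i ∧ i < k then 1 else 0))) ?_ ?_ h ha
  · intro p _
    refine ⟨x p, 0, fun i h1 h2 => ?_⟩
    obtain rfl : i = p := by omega
    simp
  · intro p k q hk hl hr hLR
    have hpk := hk.1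
    have hkq := hk.2.1
    obtain ⟨α, c1, h1⟩ := hl fun t ht ht' => hLR t ht (by omega)
    obtain ⟨β, c2, h2⟩ := hr fun t ht ht' => hLR t (by omega) ht'
    obtain ⟨hLk, hRk⟩ := hk.unique (hLR k hpk hkq)
    -- Since `a k` is smaller than every other entry of the block, it stops the search for a smaller
    -- entry: the intervals of nodes on one side of `k` never reach the other side.
    have hR : ∀ t, p < t → t < k → R t ≤ k := by
      intro t ht ht'
      by_contra hc
      have h3 := hLR t ht (by omega)
      have := h3.2.2.2.2 k (by have := h3.1; omega) (by omega) (by omega)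
      have := hk.2.2.2.2 t ht (by omega) (by omega)
      omega
    have hL : ∀ t, k < t → t < q → k ≤ L t := by
      intro t ht ht'
      by_contra hc
      have h3 := hLR t (by omega) ht'
      have := h3.2.2.2.2 k (by omega) (by have := h3.2.1; omega) (by omega)
      have := hk.2.2.2.2 t (by omega) ht' (by omega)
      omega
    -- The two sides have constants `α` and `β`. Starting from the larger one, the difference is
    -- subtracted on the other side, whose indicator is one of the two available at `k`.
    refine ⟨max α β, fun t => if t < k then c1 t else if t = k then α - β else c2 t,
      fun i hi hi' => ?_⟩
    rw [sum_Ioo_split _ hpk hkq]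
    rcases Nat.lt_or_ge i k with hik | hik
    · have e1 : ∑ t ∈ Finset.Ioo p k, (max (if t < k then c1 t else if t = k then α - β else c2 t) 0
            * (if t ≤ i ∧ i < R t then (1 : ℝ) else 0) +
          max (-(if t < k then c1 t else if t = k then α - β else c2 t)) 0 *
            (if L t ≤ i ∧ i < t then 1 else 0)) = α - x i := by
        rw [h1 i hi hik, sub_sub_cancel]
        refine Finset.sum_congr rfl fun t ht => ?_
        rw [Finset.mem_Ioo] at ht
        rw [if_pos ht.2]
      have e2 : ∑ t ∈ Finset.Ioo k q, (max (if t < k then c1 t else if t = k then α - β else c2 t) 0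
            * (if t ≤ i ∧ i < R t then (1 : ℝ) else 0) +
          max (-(if t < k then c1 t else if t = k then α - β else c2 t)) 0 *
            (if L t ≤ i ∧ i < t then 1 else 0)) = 0 := by
        refine Finset.sum_eq_zero fun t ht => ?_
        rw [Finset.mem_Ioo] at ht
        have := hL t ht.1 ht.2
        rw [if_neg (c := t ≤ i ∧ i < R t) (by omega), if_neg (c := L t ≤ i ∧ i < t) (by omega)]
        simp
      rw [e1, e2]
      dsimp only
      rw [if_neg (lt_irrefl k), if_pos rfl, if_neg (by omega), if_pos (by omega)]
      rcases le_total α β with hab | hab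
      · rw [max_eq_right hab, max_eq_left (a := -(α - β)) (by linarith)]
        ring
      · rw [max_eq_left hab, max_eq_right (a := -(α - β)) (by linarith)]
        ring
    · have e1 : ∑ t ∈ Finset.Ioo p k, (max (if t < k then c1 t else if t = k then α - β else c2 t) 0
            * (if t ≤ i ∧ i < R t then (1 : ℝ) else 0) +
          max (-(if t < k then c1 t else if t = k then α - β else c2 t)) 0 *
            (if L t ≤ i ∧ i < t then 1 else 0)) = 0 := by
        refine Finset.sum_eq_zero fun t ht => ?_
        rw [Finset.mem_Ioo] at ht
        have := hR t ht.1 ht.2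
        rw [if_neg (c := t ≤ i ∧ i < R t) (by omega), if_neg (c := L t ≤ i ∧ i < t) (by omega)]
        simp
      have e2 : ∑ t ∈ Finset.Ioo k q, (max (if t < k then c1 t else if t = k then α - β else c2 t) 0
            * (if t ≤ i ∧ i < R t then (1 : ℝ) else 0) +
          max (-(if t < k then c1 t else if t = k then α - β else c2 t)) 0 *
            (if L t ≤ i ∧ i < t then 1 else 0)) = β - x i := by
        rw [h2 i hik hi', sub_sub_cancel]
        refine Finset.sum_congr rfl fun t ht => ?_
        rw [Finset.mem_Ioo] at ht
        rw [if_neg (c := t < k) (by omega), if_neg (c := t = k) (by omega)]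
      rw [e1, e2]
      dsimp only
      rw [if_neg (lt_irrefl k), if_pos rfl, if_pos (by omega), if_neg (by omega)]
      rcases le_total α β with hab | hab
      · rw [max_eq_right hab, max_eq_right (a := α - β) (by linarith)]
        ring
      · rw [max_eq_left hab, max_eq_left (a := α - β) (by linarith)]
        ring

/-! ## The triangulation of a permutation -/

/-- The sequence `0, u(1), ..., u(n), 0, 0, ...`. -/
def valueSeq {n : ℕ} (u : Equiv.Perm (Fin n)) (k : ℕ) : ℕ :=
  if h : 1 ≤ k ∧ k ≤ n then (u ⟨k - 1, by omega⟩ : ℕ) + 1 else 0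

theorem valueSeq_add_one {n : ℕ} (u : Equiv.Perm (Fin n)) (i : Fin n) :
    valueSeq u ((i : ℕ) + 1) = (u i : ℕ) + 1 := by
  rw [valueSeq, dif_pos (by omega)]
  rfl

theorem valueSeq_zero {n : ℕ} (u : Equiv.Perm (Fin n)) : valueSeq u 0 = 0 := by
  simp [valueSeq]

theorem valueSeq_of_lt {n : ℕ} (u : Equiv.Perm (Fin n)) {k : ℕ} (h : n < k) :
    valueSeq u k = 0 := by
  rw [valueSeq, dif_neg (by omega)]

theorem injOn_valueSeq {n : ℕ} (u : Equiv.Perm (Fin n)) :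
    Set.InjOn (valueSeq u) (Set.Ioo 0 (n + 1)) := by
  intro x hx y hy h
  rw [Set.mem_Ioo] at hx hy
  rw [valueSeq, valueSeq, dif_pos (by omega), dif_pos (by omega)] at h
  have := u.injective (Fin.ext (Nat.succ_injective h))
  rw [Fin.ext_iff] at this
  simp at this
  omega

theorem isBasin_valueSeq {n : ℕ} (u : Equiv.Perm (Fin n)) : IsBasin (valueSeq u) 0 (n + 1) := by
  refine ⟨by omega, fun t h1 h2 => ?_⟩
  rw [valueSeq_zero, valueSeq_of_lt u (Nat.lt_succ_self n), valueSeq, dif_pos (by omega)]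
  omega

theorem ofFn_eq_map_valueSeq {n : ℕ} (u : Equiv.Perm (Fin n)) :
    (List.ofFn fun i => (u i : ℕ) + 1) = (List.range' 1 n).map (valueSeq u) := by
  refine List.ext_getElem (by simp) fun i h1 h2 => ?_
  simp only [List.length_ofFn] at h1
  have := valueSeq_add_one u ⟨i, h1⟩
  simpa [add_comm] using this.symm

namespace Triangulation

variable {n : ℕ}

/-- With two different apexes, a side of one triangle would cross a side of the other. -/
theorem IsTriangle.unique {T : Triangulation n} {p k k' q : ℕ} (h : T.IsTriangle p k q)
    (h' : T.IsTriangle p k' q) : k = k' := by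
  obtain ⟨h1, h2, h3, h4, h5⟩ := h
  obtain ⟨h1', h2', h3', h4', h5'⟩ := h'
  have := T.noncrossing _ _ _ _ h3 h4'
  have := T.noncrossing _ _ _ _ h3' h4
  omega

/-- If the part of `T` at a distinguished edge has the tree of a section of a sequence, then the
nodes of this section are triangles of `T`. -/
theorem isTriangle_of_isNode {T : Triangulation n} {a : ℕ → ℕ} {p q : ℕ} (h : IsBasin a p q)
    (ha : Set.InjOn a (Set.Ioo p q))
    (ht : T.TreeAt p q (minTree ((List.range' (p + 1) (q - p - 1)).map a)))
    (hd : T.IsDistinguished p q) {p' k' q' : ℕ} (hp : p ≤ p') (hq : q' ≤ q)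
    (hn : IsNode a p' k' q') : T.IsDistinguished p' q' ∧ T.IsTriangle p' k' q' := by
  revert ht hd hp hq
  refine IsBasin.induction (a := a) (motive := fun p q =>
    T.TreeAt p q (minTree ((List.range' (p + 1) (q - p - 1)).map a)) →
    T.IsDistinguished p q → p ≤ p' → q' ≤ q →
    T.IsDistinguished p' q' ∧ T.IsTriangle p' k' q') ?_ ?_ h ha
  · intro p _ _ h1 h2
    have := hn.1
    have := hn.2.1
    omega
  · intro p k q hk hl hr ht hd hp hq
    have hpk := hk.1
    have hkq := hk.2.1
    have hne : (List.range' (p + 1) (q - p - 1)).map a ≠ [] := by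
      simp; omega
    -- The list starts at position `p + 1`, so position `k` has index `k - p - 1`.
    have hidx : ((List.range' (p + 1) (q - p - 1)).map a).minIdxOn id hne = k - p - 1 := by
      rw [List.minIdxOn_eq_iff]
      refine ⟨by simp; omega, fun j hj => ?_, fun j hj => ?_⟩
      · simp only [List.length_map, List.length_range'] at hj
        simp only [List.getElem_map, List.getElem_range', id]
        rcases eq_or_ne j (k - p - 1) with rfl | hne'
        · rfl
        · rw [show p + 1 + 1 * (k - p - 1) = k by omega]
          exact (hk.2.2.2.2 _ (by omega) (by omega) (by omega)).le
      · simp only [List.getElem_map, List.getElem_range', id]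
        rw [show p + 1 + 1 * (k - p - 1) = k by omega]
        exact hk.2.2.2.2 _ (by omega) (by omega) (by omega)
    rw [minTree, dif_neg hne, hidx, ← List.map_take, ← List.map_drop,
      List.take_range'_of_length_ge (by omega), List.drop_range'] at ht
    rw [show p + 1 + (k - p - 1 + 1) * 1 = k + 1 by omega,
      show q - p - 1 - (k - p - 1 + 1) = q - k - 1 by omega] at ht
    cases ht with
    | node h3 h1 h2 =>
      rename_i k''
      -- The number of nodes of the left subtree fixes the apex of the triangle.
      have e := (subset_of_treeAt h1).1
      rw [numNodes_minTree, List.length_map, List.length_range'] at e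
      obtain rfl : k'' = k := by omega
      rcases hk.cases_of_le hn hp hq with ⟨rfl, rfl, rfl⟩ | hc | hc
      · exact ⟨hd, h3⟩
      · exact hl h1 (.left hd h3) hp hc
      · exact hr h2 (.right hd h3) hc hq

end Triangulation

theorem treeAt_psi {n : ℕ} (u : Equiv.Perm (Fin n)) :
    (psi u).TreeAt 0 (n + 1) (minTree ((List.range' 1 n).map (valueSeq u))) := by
  rw [← ofFn_eq_map_valueSeq]
  exact (hasTree_iff (psi u) (permTree u) (numNodes_permTree u)).mpr rfl

theorem isTriangle_psi_of_isNode {n : ℕ} (u : Equiv.Perm (Fin n)) {p k q : ℕ} (hq : q ≤ n + 1)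
    (h : IsNode (valueSeq u) p k q) :
    (psi u).IsDistinguished p q ∧ (psi u).IsTriangle p k q :=
  Triangulation.isTriangle_of_isNode (isBasin_valueSeq u) (injOn_valueSeq u) (treeAt_psi u) .base
    (Nat.zero_le p) hq h

/-- The distinguished edges are basins. -/
theorem isBasin_of_isDistinguished {n : ℕ} (u : Equiv.Perm (Fin n)) {p q : ℕ}
    (h : (psi u).IsDistinguished p q) : IsBasin (valueSeq u) p q ∧ q ≤ n + 1 := by
  -- The basin has a node, this node is a triangle at the same edge, and the apex at an edge is
  -- unique.
  have key : ∀ p k q, IsBasin (valueSeq u) p q → q ≤ n + 1 → (psi u).IsTriangle p k q →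
      IsNode (valueSeq u) p k q := by
    intro p k q h1 h2 h3
    have := h3.1
    have := h3.2.1
    obtain ⟨k', hk'⟩ := h1.exists_isNode (by omega)
      ((injOn_valueSeq u).mono (Set.Ioo_subset_Ioo (Nat.zero_le p) h2))
    rwa [h3.unique (isTriangle_psi_of_isNode u h2 hk').2]
  induction h with
  | base => exact ⟨isBasin_valueSeq u, le_rfl⟩
  | left _ h1 ih =>
    have := key _ _ _ ih.1 ih.2 h1
    exact ⟨this.isBasin_left, this.2.1.le.trans ih.2⟩
  | right _ h1 ih => exact ⟨(key _ _ _ ih.1 ih.2 h1).isBasin_right, ih.2⟩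

theorem isDistinguished_and_isTriangle_psi_iff {n : ℕ} (u : Equiv.Perm (Fin n)) {p k q : ℕ} :
    (psi u).IsDistinguished p q ∧ (psi u).IsTriangle p k q ↔
      q ≤ n + 1 ∧ IsNode (valueSeq u) p k q := by
  constructor
  · rintro ⟨h1, h2⟩
    obtain ⟨h3, h4⟩ := isBasin_of_isDistinguished u h1
    have := h2.1
    have := h2.2.1
    obtain ⟨k', hk'⟩ := h3.exists_isNode (by omega)
      ((injOn_valueSeq u).mono (Set.Ioo_subset_Ioo (Nat.zero_le p) h4))
    rw [h2.unique (isTriangle_psi_of_isNode u h4 hk').2]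
    exact ⟨h4, hk'⟩
  · rintro ⟨h1, h2⟩
    exact isTriangle_psi_of_isNode u h1 h2

/-! ## Normal fans of polytopes with the combinatorics of a cube -/

theorem toNR_mem_normalCone {n : ℕ} {P F : Set (Fin (n + 1) → ℝ)} {S : ℝ}
    (hP : ∀ x ∈ P, ∑ i, x i = S) (hF : F ⊆ P) (x : Fin (n + 1) → ℝ) :
    toNR n x ∈ normalCone P F ↔ ∀ y ∈ F, ∀ z ∈ P, x ⬝ᵥ y ≤ x ⬝ᵥ z := by
  have hMR : ∀ y ∈ F, ∀ z ∈ P, z - y ∈ MR n := by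
    intro y hy z hz
    change ∑ i, (z - y) i = 0
    simp [Finset.sum_sub_distrib, hP y (hF hy), hP z hz]
  constructor
  · intro h y hy z hz
    have := h y hy z hz (hMR y hy z hz)
    rwa [pairing_toNR, dotProduct_sub, sub_nonneg] at this
  · intro h y hy z hz h'
    rw [pairing_toNR, dotProduct_sub, sub_nonneg]
    exact h y hy z hz

theorem toNR_one (n : ℕ) : toNR n (fun _ => 1) = 0 := by
  rw [toNR, Submodule.mkQ_apply, Submodule.Quotient.mk_eq_zero]
  exact Submodule.mem_span_singleton_self _

/-- A set with two opposite facets for every `k ∈ K`, given by the inequalities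
`m k b ≤ g k b ⬝ᵥ x`, and with a point on every choice of one facet for each `k`, such that the
vectors `g k b` of the corresponding choices positively span the space. -/
structure IsCubical {n : ℕ} (P : Set (Fin (n + 1) → ℝ)) (K : Finset ℕ)
    (g : ℕ → Bool → Fin (n + 1) → ℝ) (m : ℕ → Bool → ℝ) : Prop where
  sum_eq : ∃ S, ∀ x ∈ P, ∑ i, x i = S
  le_dotProduct : ∀ k ∈ K, ∀ b, ∀ x ∈ P, m k b ≤ g k b ⬝ᵥ x
  exists_vertex : ∀ ε : ℕ → Bool, ∃ x ∈ P, ∀ k ∈ K,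
    g k (ε k) ⬝ᵥ x = m k (ε k) ∧ m k (!ε k) < g k (!ε k) ⬝ᵥ x
  exists_combination : ∀ x : Fin (n + 1) → ℝ, ∃ (d : ℝ) (ε : ℕ → Bool) (c : ℕ → ℝ),
    (∀ k, 0 ≤ c k) ∧ x = d • (fun _ => 1) + ∑ k ∈ K, c k • g k (ε k)

/-- The face on which the inequalities indexed by `Q` are equalities. -/
def tightFace {n : ℕ} (P : Set (Fin (n + 1) → ℝ)) (g : ℕ → Bool → Fin (n + 1) → ℝ)
    (m : ℕ → Bool → ℝ) (Q : Set (ℕ × Bool)) : Set (Fin (n + 1) → ℝ) :=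
  {x ∈ P | ∀ q ∈ Q, g q.1 q.2 ⬝ᵥ x = m q.1 q.2}

/-- `Q` contains at most one of `(k, true)` and `(k, false)`, and only for `k ∈ K`. -/
def IsChoice (K : Finset ℕ) (Q : Set (ℕ × Bool)) : Prop :=
  (∀ q ∈ Q, q.1 ∈ K) ∧ ∀ k b, (k, b) ∈ Q → (k, !b) ∉ Q

namespace IsCubical

variable {n : ℕ} {P : Set (Fin (n + 1) → ℝ)} {K : Finset ℕ} {g : ℕ → Bool → Fin (n + 1) → ℝ}
  {m : ℕ → Bool → ℝ}

/-- The vertex that takes `b` at `k` and agrees with `Q` elsewhere. It separates the face of `Q`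
from the facet `(k, !b)`. -/
theorem exists_mem_tightFace (h : IsCubical P K g m) {Q : Set (ℕ × Bool)} (hQ : IsChoice K Q)
    (k : ℕ) (b : Bool) (hk : k ∈ K) (hb : (k, !b) ∉ Q) :
    ∃ x ∈ tightFace P g m Q, g k b ⬝ᵥ x = m k b ∧ m k (!b) < g k (!b) ⬝ᵥ x := by
  classical
  obtain ⟨x, hx, hx'⟩ := h.exists_vertex fun i => if i = k then b else decide ((i, true) ∈ Q)
  refine ⟨x, ⟨hx, ?_⟩, by simpa using hx' k hk⟩
  rintro ⟨i, c⟩ hq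
  have := (hx' i (hQ.1 _ hq)).1
  have e : (if i = k then b else decide ((i, true) ∈ Q)) = c := by
    split_ifs with hi
    · subst hi
      by_contra hne
      have : c = !b := by revert hne; cases b <;> cases c <;> simp
      exact hb (this ▸ hq)
    · cases c
      · simpa using hQ.2 i false hq
      · simpa using hq
  rwa [e] at this

theorem tightFace_nonempty (h : IsCubical P K g m) {Q : Set (ℕ × Bool)} (hQ : IsChoice K Q) :
    (tightFace P g m Q).Nonempty := by
  classical
  obtain ⟨x, hx, hx'⟩ := h.exists_vertex fun i => decide ((i, true) ∈ Q)
  refine ⟨x, hx, ?_⟩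
  rintro ⟨i, c⟩ hq
  have := (hx' i (hQ.1 _ hq)).1
  have e : decide ((i, true) ∈ Q) = c := by
    cases c
    · simpa using hQ.2 i false hq
    · simpa using hq
  rwa [e] at this

/-- The face on which a nonnegative combination of the facet functionals is minimal. -/
theorem argmin_eq_tightFace (h : IsCubical P K g m) {Q : Set (ℕ × Bool)} (hQ : IsChoice K Q)
    (C : ℕ × Bool → ℝ) (hC : ∀ q, 0 ≤ C q) (hCQ : ∀ q ∈ K ×ˢ Finset.univ, 0 < C q ↔ q ∈ Q)
    (d : ℝ) (x : Fin (n + 1) → ℝ)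
    (hx : x = d • (fun _ => 1) + ∑ q ∈ K ×ˢ Finset.univ, C q • g q.1 q.2) :
    {y ∈ P | ∀ z ∈ P, x ⬝ᵥ y ≤ x ⬝ᵥ z} = tightFace P g m Q := by
  obtain ⟨S, hS⟩ := h.sum_eq
  have hdot : ∀ y ∈ P, x ⬝ᵥ y = d * S + ∑ q ∈ K ×ˢ Finset.univ, C q * (g q.1 q.2 ⬝ᵥ y) := by
    intro y hy
    rw [hx, add_dotProduct, sum_dotProduct, smul_dotProduct]
    simp only [smul_dotProduct, smul_eq_mul]
    congr 2
    rw [← hS y hy]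
    simp [dotProduct]
  have hle : ∀ y ∈ P, ∀ q ∈ K ×ˢ Finset.univ, C q * m q.1 q.2 ≤ C q * (g q.1 q.2 ⬝ᵥ y) :=
    fun y hy q hq => mul_le_mul_of_nonneg_left
      (h.le_dotProduct _ (Finset.mem_product.mp hq).1 _ y hy) (hC q)
  have heq : ∀ y ∈ tightFace P g m Q,
      x ⬝ᵥ y = d * S + ∑ q ∈ K ×ˢ Finset.univ, C q * m q.1 q.2 := by
    intro y hy
    rw [hdot y hy.1]
    congr 1
    refine Finset.sum_congr rfl fun q hq => ?_
    by_cases hqQ : q ∈ Q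
    · rw [hy.2 q hqQ]
    · rw [le_antisymm (not_lt.mp fun h => hqQ ((hCQ q hq).mp h)) (hC q), zero_mul, zero_mul]
  ext y
  constructor
  · rintro ⟨hy, hmin⟩
    refine ⟨hy, fun q hqQ => ?_⟩
    obtain ⟨z, hz⟩ := h.tightFace_nonempty hQ
    have h1 := hmin z hz.1
    rw [heq z hz, hdot y hy, add_le_add_iff_left] at h1
    have hq : q ∈ K ×ˢ Finset.univ := Finset.mem_product.mpr ⟨hQ.1 q hqQ, Finset.mem_univ _⟩
    -- A minimiser does as well as a point of the face, so the termwise inequalities must all be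
    -- equalities.
    have h2 := (Finset.sum_eq_sum_iff_of_le (hle y hy)).mp
      (le_antisymm (Finset.sum_le_sum (hle y hy)) h1) q hq
    exact (mul_left_cancel₀ ((hCQ q hq).mpr hqQ).ne' h2).symm
  · intro hy
    refine ⟨hy.1, fun z hz => ?_⟩
    rw [heq y hy, hdot z hz, add_le_add_iff_left]
    exact Finset.sum_le_sum (hle z hz)

theorem normalCone_tightFace (h : IsCubical P K g m) {Q : Set (ℕ × Bool)} (hQ : IsChoice K Q) :
    normalCone P (tightFace P g m Q) =
      PointedCone.hull ℝ ((fun q : ℕ × Bool => toNR n (g q.1 q.2)) '' Q) := by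
  obtain ⟨S, hS⟩ := h.sum_eq
  apply le_antisymm
  · intro ξ hξ
    obtain ⟨x, rfl⟩ := Submodule.mkQ_surjective _ ξ
    change toNR n x ∈ _ at hξ
    change toNR n x ∈ _
    rw [toNR_mem_normalCone hS fun y hy => hy.1] at hξ
    obtain ⟨d, ε, c, hc, rfl⟩ := h.exists_combination x
    have hdot : ∀ y ∈ P, (d • (fun _ => 1) + ∑ k ∈ K, c k • g k (ε k)) ⬝ᵥ y =
        d * S + ∑ k ∈ K, c k * (g k (ε k) ⬝ᵥ y) := by
      intro y hy
      rw [add_dotProduct, sum_dotProduct, smul_dotProduct]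
      simp only [smul_dotProduct, smul_eq_mul]
      congr 2
      rw [← hS y hy]
      simp [dotProduct]
    have hmem : ∀ k ∈ K, c k ≠ 0 → (k, ε k) ∈ Q := by
      intro k hk hck
      by_contra hkQ
      -- A positive coefficient outside `Q` is impossible: the vertex of `ε` minimises every term at
      -- once, and is strictly better than a point of the face lying off the facet `(k, ε k)`.
      obtain ⟨y, hy, hy1, hy2⟩ := h.exists_mem_tightFace hQ k (!ε k) hk (by simpa using hkQ)
      rw [Bool.not_not] at hy2
      obtain ⟨z, hz, hz'⟩ := h.exists_vertex ε
      have h1 := hξ y hy z hz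
      rw [hdot y hy.1, hdot z hz, add_le_add_iff_left] at h1
      have h2 : ∑ i ∈ K, c i * (g i (ε i) ⬝ᵥ z) < ∑ i ∈ K, c i * (g i (ε i) ⬝ᵥ y) := by
        refine Finset.sum_lt_sum (fun i hi => ?_) ⟨k, hk, ?_⟩
        · rw [(hz' i hi).1]
          exact mul_le_mul_of_nonneg_left (h.le_dotProduct i hi _ y hy.1) (hc i)
        · rw [(hz' k hk).1]
          exact mul_lt_mul_of_pos_left hy2 (lt_of_le_of_ne (hc k) hck.symm)
      exact absurd h1 (not_le.mpr h2)
    rw [map_add, map_smul, toNR_one, smul_zero, zero_add, map_sum]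
    refine Submodule.sum_mem _ fun k hk => ?_
    rw [map_smul]
    by_cases hck : c k = 0
    · rw [hck, zero_smul]
      exact Submodule.zero_mem _
    · exact Submodule.smul_mem _ (⟨c k, hc k⟩ : {x : ℝ // 0 ≤ x})
        (Submodule.subset_span ⟨(k, ε k), hmem k hk hck, rfl⟩)
  · refine Submodule.span_le.mpr ?_
    rintro _ ⟨q, hq, rfl⟩
    rw [SetLike.mem_coe, toNR_mem_normalCone hS fun y hy => hy.1]
    intro y hy z hz
    rw [hy.2 q hq]
    exact h.le_dotProduct _ (hQ.1 q hq) _ z hz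

theorem isExposed_tightFace (h : IsCubical P K g m) {Q : Set (ℕ × Bool)} (hQ : IsChoice K Q) :
    IsExposed ℝ P (tightFace P g m Q) := by
  classical
  intro _
  have h1 := h.argmin_eq_tightFace hQ (fun q => if q ∈ Q then 1 else 0)
    (fun q => by split_ifs <;> norm_num) (fun q _ => by split_ifs with hq <;> simp [hq]) 0 _ rfl
  generalize (0 : ℝ) • (fun _ => (1 : ℝ)) + ∑ q ∈ K ×ˢ Finset.univ,
    (if q ∈ Q then (1 : ℝ) else 0) • g q.1 q.2 = x at h1
  -- Exposed faces maximise while inner normals minimise, hence the sign. The functional is minus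
  -- the sum of the normals in `Q`.
  refine ⟨-∑ i, x i • ContinuousLinearMap.proj (R := ℝ) (φ := fun _ : Fin (n + 1) => ℝ) i, ?_⟩
  rw [← h1]
  ext y
  simp [dotProduct]

theorem exists_eq_tightFace (h : IsCubical P K g m) {F : Set (Fin (n + 1) → ℝ)}
    (hF : F.Nonempty) (hF' : IsExposed ℝ P F) : ∃ Q, IsChoice K Q ∧ F = tightFace P g m Q := by
  classical
  obtain ⟨l, rfl⟩ := hF' hF
  obtain ⟨w, hl⟩ : ∃ w, ∀ y, l y = -(w ⬝ᵥ y) := by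
    refine ⟨fun i => -l (Pi.single i 1), fun y => ?_⟩
    have := LinearMap.pi_apply_eq_sum_univ l.toLinearMap y
    simp only [ContinuousLinearMap.coe_coe, smul_eq_mul] at this
    rw [this]
    simp only [dotProduct, neg_mul, Finset.sum_neg_distrib, neg_neg]
    refine Finset.sum_congr rfl fun i _ => ?_
    rw [mul_comm]
    congr 2
    ext j
    rcases eq_or_ne i j with rfl | hij
    · simp
    · simp [hij, hij.symm]
  -- The face is cut out by the facets that occur with positive coefficient.
  obtain ⟨d, ε, c, hc, hx⟩ := h.exists_combination w
  have hQ : IsChoice K {q : ℕ × Bool | q.1 ∈ K ∧ 0 < c q.1 ∧ q.2 = ε q.1} := by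
    refine ⟨fun q hq => hq.1, fun k b hb hb' => ?_⟩
    have h1 := hb.2.2
    have h2 := hb'.2.2
    simp only at h1 h2
    rw [← h1] at h2
    simp at h2
  refine ⟨_, hQ, ?_⟩
  rw [← h.argmin_eq_tightFace hQ (fun q => if q.2 = ε q.1 then c q.1 else 0)
    (fun q => by split_ifs; exacts [hc _, le_rfl]) ?_ d w ?_]
  · ext y
    simp only [hl, neg_le_neg_iff]
  · rintro ⟨k, b⟩ hq
    have := (Finset.mem_product.mp hq).1
    by_cases hb : b = ε k <;> simp_all
  · rw [hx, Finset.sum_product]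
    congr 1
    refine Finset.sum_congr rfl fun k _ => ?_
    simp [ite_smul]

theorem normalFan_eq (h : IsCubical P K g m) :
    normalFan P = {σ | ∃ Q, IsChoice K Q ∧
      σ = PointedCone.hull ℝ ((fun q : ℕ × Bool => toNR n (g q.1 q.2)) '' Q)} := by
  ext σ
  constructor
  · rintro ⟨F, h1, h2, rfl⟩
    obtain ⟨Q, hQ, rfl⟩ := h.exists_eq_tightFace h1 h2
    exact ⟨Q, hQ, h.normalCone_tightFace hQ⟩
  · rintro ⟨Q, hQ, rfl⟩
    exact ⟨_, h.tightFace_nonempty hQ, h.isExposed_tightFace hQ,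
      (h.normalCone_tightFace hQ).symm⟩

/-- The vectors of the facets are pairwise distinct. -/
theorem toNR_injective (h : IsCubical P K g m) {k k' : ℕ} {b b' : Bool} (hk : k ∈ K)
    (hk' : k' ∈ K) (he : toNR n (g k b) = toNR n (g k' b')) : k = k' ∧ b = b' := by
  classical
  obtain ⟨S, hS⟩ := h.sum_eq
  -- A vertex on the facet `(k, b)` minimises the common functional, so it also lies on `(k', b')`.
  -- As the choices at different indices are free, the two indices must agree.
  have key : ∀ ε : ℕ → Bool, ε k = b → ε k' = b' := by
    intro ε hε
    by_contra hε'
    obtain ⟨x, hx, hx'⟩ := h.exists_vertex ε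
    have h1 : toNR n (g k b) ∈ normalCone P {x} := by
      rw [toNR_mem_normalCone hS (Set.singleton_subset_iff.mpr hx)]
      rintro y rfl z hz
      have := (hx' k hk).1
      rw [hε] at this
      rw [this]
      exact h.le_dotProduct k hk b z hz
    rw [he, toNR_mem_normalCone hS (Set.singleton_subset_iff.mpr hx)] at h1
    obtain ⟨y, hy, hy'⟩ := h.exists_vertex fun _ => b'
    have h2 := h1 x rfl y hy
    have h3 := (hx' k' hk').2
    have h4 : (!ε k') = b' := by revert hε'; cases ε k' <;> cases b' <;> simp
    rw [h4] at h3
    rw [(hy' k' hk').1] at h2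
    exact absurd h2 (not_le.mpr h3)
  by_cases hkk : k = k'
  · subst hkk
    exact ⟨rfl, key (fun _ => b) rfl⟩
  · have := key (fun i => if i = k then b else !b') (by simp)
    simp [Ne.symm hkk] at this

end IsCubical

/-! ## The Bruhat interval polytope of a permutation -/

theorem head_apply_val {n : ℕ} (u : Equiv.Perm (Fin n)) (i : Fin (n + 1)) :
    (head u i : ℕ) = valueSeq u i := by
  induction i using Fin.cases with
  | zero => simp [head, valueSeq_zero]
  | succ i => simp [head, valueSeq_add_one]

theorem wordProd_take_finRange_apply {n : ℕ} (m : ℕ) (hm : m ≤ n) (i : Fin (n + 1)) :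
    (wordProd ((List.finRange n).take m) i : ℕ) =
      if (i : ℕ) < m then (i : ℕ) + 1 else if (i : ℕ) = m then 0 else i := by
  induction m generalizing i with
  | zero =>
    simp only [List.take_zero, wordProd, List.map_nil, List.prod_nil, Equiv.Perm.coe_one, id,
      Nat.not_lt_zero, if_false]
    split_ifs with h <;> simp [h]
  | succ m ih =>
    rw [List.take_succ_eq_append_getElem (by simpa using hm), wordProd_append_singleton,
      Equiv.Perm.mul_apply, ih (by omega)]
    have hs : (simpleTransposition (⟨m, hm⟩ : Fin n) i : ℕ) =
        if (i : ℕ) = m then m + 1 else if (i : ℕ) = m + 1 then m else i := by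
      simp only [simpleTransposition, Equiv.swap_apply_def, Fin.ext_iff]
      split_ifs with h1 h2 h2 h3 h3 <;> simp at * <;> omega
    simp only [List.getElem_finRange, Fin.cast_mk]
    rw [hs]
    split_ifs <;> omega

theorem head_mul_ascendingProd_apply_val {n : ℕ} (u : Equiv.Perm (Fin n)) (i : Fin (n + 1)) :
    ((head u * ascendingProd n) i : ℕ) = valueSeq u ((i : ℕ) + 1) := by
  have h := wordProd_take_finRange_apply n le_rfl i
  rw [List.take_of_length_le (by simp)] at h
  rw [Equiv.Perm.mul_apply, head_apply_val, ascendingProd, h]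
  split_ifs with h1 h2
  · rfl
  · rw [valueSeq_zero, valueSeq_of_lt u (by omega)]
  · omega

theorem prefixCount_eq_sum {n : ℕ} (z : Equiv.Perm (Fin (n + 1))) (f : ℕ → ℕ)
    (hf : ∀ i, (z i : ℕ) = f i) (i j : ℕ) (hi : i ≤ n + 1) :
    prefixCount z i j = ∑ x ∈ Finset.range i, if j ≤ f x then 1 else 0 := by
  induction i with
  | zero => simp [prefixCount_zero]
  | succ i ih =>
    have := prefixCount_succ z ⟨i, hi⟩ j
    rw [Finset.sum_range_succ, ← ih (by omega), this, hf]

theorem sum_Ioc_ite_le (N v : ℕ) (h : v ≤ N) :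
    ∑ j ∈ Finset.Ioc 0 N, (if j ≤ v then 1 else 0) = v := by
  rw [← Finset.card_filter]
  have : (Finset.Ioc 0 N).filter (· ≤ v) = Finset.Ioc 0 v := by
    ext; simp; omega
  simp [this]

theorem valueSeq_le {n : ℕ} (u : Equiv.Perm (Fin n)) (k : ℕ) : valueSeq u k ≤ n := by
  rw [valueSeq]
  split_ifs <;> omega

/-- The facet inequalities: the entries of a permutation of the interval at the positions
`p, ..., q - 1` have at most the sum of the entries `p, ..., q` of the sequence of `u` without the
smallest one, if this is the first or the last one. -/
theorem sum_Ico_add_le {n : ℕ} (u : Equiv.Perm (Fin n)) {z : Equiv.Perm (Fin (n + 1))}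
    (hv : BruhatLE (head u) z) (hw : BruhatLE z (head u * ascendingProd n)) (f : ℕ → ℕ)
    (hf : ∀ i, (z i : ℕ) = f i) {p q e : ℕ} (hpq : p ≤ q) (hq : q ≤ n + 1)
    (he : ∀ t, p ≤ t → t ≤ q → valueSeq u e ≤ valueSeq u t) :
    ∑ i ∈ Finset.Ico p q, f i + valueSeq u e ≤ ∑ t ∈ Finset.Ico p (q + 1), valueSeq u t := by
  rw [bruhatLE_iff_rankLE] at hv hw
  have key : ∀ j, 0 < j → ∑ i ∈ Finset.Ico p q, (if j ≤ f i then 1 else 0) +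
      (if j ≤ valueSeq u e then 1 else 0) ≤
        ∑ t ∈ Finset.Ico p (q + 1), if j ≤ valueSeq u t then 1 else 0 := by
    intro j hj
    -- For these thresholds all `q + 1 - p` entries of `a` count, while `z` has only `q - p`
    -- positions: this leaves room for the extra term. For larger `j`, the upper rank bound at `q`
    -- and the lower one at `p` are subtracted.
    by_cases hje : j ≤ valueSeq u e
    · rw [if_pos hje]
      have h1 : ∑ t ∈ Finset.Ico p (q + 1), (if j ≤ valueSeq u t then 1 else 0) = q + 1 - p := by
        rw [Finset.sum_congr rfl fun t ht => if_pos ?_]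
        · simp
        · rw [Finset.mem_Ico] at ht
          exact hje.trans (he t ht.1 (by omega))
      have h2 : ∑ i ∈ Finset.Ico p q, (if j ≤ f i then 1 else 0) ≤ q - p := by
        refine (Finset.sum_le_card_nsmul _ _ 1 fun i _ => ?_).trans (by simp)
        split_ifs <;> simp
      omega
    · rw [if_neg hje, add_zero]
      have h1 := hv p j
      have h2 := hw q j
      rw [prefixCount_eq_sum z f hf _ _ (by omega),
        prefixCount_eq_sum _ _ (head_apply_val u) _ _ (by omega)] at h1
      rw [prefixCount_eq_sum z f hf _ _ (by omega), prefixCount_eq_sum _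
        (fun i => valueSeq u (i + 1)) (head_mul_ascendingProd_apply_val u) _ _ (by omega)] at h2
      have h3 := Finset.sum_range_add_sum_Ico (fun x => if j ≤ f x then 1 else 0) hpq
      have h4 := Finset.sum_range_add_sum_Ico (fun x => if j ≤ valueSeq u x then 1 else 0)
        (show p ≤ q + 1 by omega)
      have h5 := Finset.sum_range_succ' (fun x => if j ≤ valueSeq u x then 1 else 0) q
      -- As `0 < j`, the entry `a(0) = 0` is never counted, so the shift in the top permutation
      -- costs nothing.
      rw [valueSeq_zero, if_neg (by omega)] at h5
      omega
  have h0 : ∀ i ∈ Finset.Ico p q, f i ≤ n := by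
    intro i hi
    rw [Finset.mem_Ico] at hi
    have := hf ⟨i, by omega⟩
    simp only at this
    omega
  -- Each value is the number of thresholds `1, ..., n` that it reaches; exchanging the sums reduces
  -- the claim to single thresholds.
  rw [← sum_Ioc_ite_le n (valueSeq u e) (valueSeq_le u e),
    Finset.sum_congr rfl fun i hi => (sum_Ioc_ite_le n (f i) (h0 i hi)).symm,
    Finset.sum_congr rfl fun i _ => (sum_Ioc_ite_le n (valueSeq u i) (valueSeq_le u i)).symm,
    Finset.sum_comm, Finset.sum_comm (s := Finset.Ico p (q + 1)), ← Finset.sum_add_distrib]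
  exact Finset.sum_le_sum fun j hj => key j (Finset.mem_Ioc.mp hj).1

/-! ### Vertices for all choices of facets -/

theorem sum_Ioo_valueSeq {n : ℕ} (u : Equiv.Perm (Fin n)) (f : ℕ → ℕ) :
    f 0 + ∑ t ∈ Finset.Ioo 0 (n + 1), f (valueSeq u t) = ∑ y ∈ Finset.range (n + 1), f y := by
  have h := Equiv.sum_comp u fun y : Fin n => f ((y : ℕ) + 1)
  have h1 := sum_Ico_eq_add_sum_Ioo (fun t => f (valueSeq u t)) (Nat.succ_pos n)
  rw [valueSeq_zero] at h1
  rw [← h1, ← Finset.range_eq_Ico, Finset.sum_range_succ', Finset.sum_range_succ', valueSeq_zero,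
    Finset.sum_range, Finset.sum_range, ← h]
  simp only [valueSeq_add_one]

/-- Equality of multisets is expressed by sums of test functions. The indicator of the values above
`n` bounds the range of `f`, and the indicators of single values give surjectivity. -/
theorem exists_perm_of_sum_eq {n : ℕ} (f : ℕ → ℕ)
    (h : ∀ φ : ℕ → ℕ, ∑ i ∈ Finset.range (n + 1), φ (f i) = ∑ y ∈ Finset.range (n + 1), φ y) :
    ∃ z : Equiv.Perm (Fin (n + 1)), ∀ i, (z i : ℕ) = f i := by
  have hlt : ∀ i : Fin (n + 1), f i < n + 1 := by
    intro i
    have h1 := h fun y => if n + 1 ≤ y then 1 else 0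
    rw [Finset.sum_eq_zero (s := Finset.range (n + 1)) (f := fun y => if n + 1 ≤ y then 1 else 0)
      fun y hy => if_neg (by simpa using hy), Finset.sum_eq_zero_iff] at h1
    have := h1 i (Finset.mem_range.mpr i.2)
    by_contra hc
    simp at this
    omega
  have hsurj : Function.Surjective fun i : Fin (n + 1) => (⟨f i, hlt i⟩ : Fin (n + 1)) := by
    intro y
    have h1 := h fun x => if x = y then 1 else 0
    rw [Finset.sum_ite_eq' (Finset.range (n + 1)) (y : ℕ), if_pos (Finset.mem_range.mpr y.2)] at h1
    obtain ⟨i, hi, hi'⟩ := Finset.exists_ne_zero_of_sum_ne_zero (h1 ▸ one_ne_zero)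
    rw [Finset.mem_range] at hi
    refine ⟨⟨i, hi⟩, Fin.ext ?_⟩
    by_contra hc
    exact hi' (if_neg hc)
  exact ⟨Equiv.ofBijective _ (Finite.surjective_iff_bijective.mp hsurj), fun i => rfl⟩

/-- For every choice of one of the two facets at each node, the interval contains a permutation on
exactly these facets. -/
theorem exists_vertex_perm {n : ℕ} (u : Equiv.Perm (Fin n)) (ε : ℕ → Bool) :
    ∃ (z : Equiv.Perm (Fin (n + 1))) (f : ℕ → ℕ), (∀ i, (z i : ℕ) = f i) ∧
      BruhatLE (head u) z ∧ BruhatLE z (head u * ascendingProd n) ∧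
      ∀ p k q, q ≤ n + 1 → IsNode (valueSeq u) p k q →
        (ε k = true → ∑ i ∈ Finset.Ico k q, f i = ∑ i ∈ Finset.Ico k q, valueSeq u i ∧
          ∑ i ∈ Finset.Ico p k, f i < ∑ i ∈ Finset.Ioc p k, valueSeq u i) ∧
        (ε k = false → ∑ i ∈ Finset.Ico p k, f i = ∑ i ∈ Finset.Ioc p k, valueSeq u i ∧
          ∑ i ∈ Finset.Ico k q, f i < ∑ i ∈ Finset.Ico k q, valueSeq u i) := by
  obtain ⟨f, h1, h2, h3⟩ := (isBasin_valueSeq u).exists_values (injOn_valueSeq u) ε 0 (by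
    intro t ht ht'
    have := ((isBasin_valueSeq u).2 t ht ht').1
    omega)
  obtain ⟨z, hz⟩ := exists_perm_of_sum_eq (n := n) f fun φ => by
    rw [Finset.range_eq_Ico, h1 φ, sum_Ioo_valueSeq, ← Finset.range_eq_Ico]
  refine ⟨z, f, hz, ?_, ?_, fun p k q hq h => h3 p k q (Nat.zero_le p) hq h⟩
  all_goals
    rw [bruhatLE_iff_rankLE]
    intro i j
    have hmono : Monotone fun x : ℕ => if j ≤ x then 1 else 0 := by
      intro x y hxy
      dsimp only
      split_ifs <;> omega
    rcases Nat.lt_or_ge i (n + 1) with hi | hi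
    swap
    · rw [prefixCount_of_le _ _ hi, prefixCount_of_le _ _ hi]
    rcases Nat.eq_zero_or_pos i with rfl | hi0
    · rw [prefixCount_zero, prefixCount_zero]
    have h4 := h2 _ hmono i hi0 hi
    rw [prefixCount_eq_sum z f hz _ _ hi.le]
  · rw [prefixCount_eq_sum _ _ (head_apply_val u) _ _ hi.le, Finset.range_eq_Ico,
      sum_Ico_eq_add_sum_Ioo _ hi0, valueSeq_zero]
    exact h4.1
  · rw [prefixCount_eq_sum _ (fun i => valueSeq u (i + 1)) (head_mul_ascendingProd_apply_val u) _ _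
      hi.le]
    rw [Finset.range_eq_Ico, Finset.sum_Ico_add' (fun x => if j ≤ valueSeq u x then 1 else 0) 0 i 1]
    exact h4.2

/-- The negative of the indicator of the positions `p, ..., q - 1`. -/
def negIndicator (n p q : ℕ) : Fin (n + 1) → ℝ :=
  fun i => -(if p ≤ (i : ℕ) ∧ (i : ℕ) < q then 1 else 0)

/-- The term `q - p` appears because `permPoint` counts values from 1 and `f` from 0. -/
theorem negIndicator_dotProduct_permPoint {n : ℕ} (z : Equiv.Perm (Fin (n + 1))) (f : ℕ → ℕ)
    (hf : ∀ i, (z i : ℕ) = f i) {p q : ℕ} (hq : q ≤ n + 1) :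
    negIndicator n p q ⬝ᵥ permPoint z =
      -((∑ i ∈ Finset.Ico p q, f i : ℕ) : ℝ) - (q - p : ℕ) := by
  have h : negIndicator n p q ⬝ᵥ permPoint z =
      ∑ i : Fin (n + 1), if p ≤ (i : ℕ) ∧ (i : ℕ) < q then -((f i : ℝ) + 1) else 0 := by
    refine Finset.sum_congr rfl fun i _ => ?_
    rw [negIndicator, permPoint, hf]
    split_ifs <;> ring
  rw [h, ← Finset.sum_range fun i => if p ≤ i ∧ i < q then -((f i : ℝ) + 1) else 0,
    ← Finset.sum_filter]
  have e : (Finset.range (n + 1)).filter (fun i => p ≤ i ∧ i < q) = Finset.Ico p q := by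
    ext; simp; omega
  rw [e, Finset.sum_neg_distrib, Finset.sum_add_distrib]
  simp
  ring

theorem toNR_negIndicator {n p q : ℕ} (h : p ≤ q) :
    toNR n (negIndicator n p q) = varpi n p - varpi n q := by
  rw [varpi, varpi, ← map_sub]
  congr 1
  ext i
  simp only [negIndicator, Pi.sub_apply]
  split_ifs <;> first | omega | norm_num

/-- The functionals of the two facets at `k`, where `L k` and `R k` are the nearest positions with
smaller entries. -/
def facetVector (n : ℕ) (L R : ℕ → ℕ) (k : ℕ) (b : Bool) : Fin (n + 1) → ℝ :=
  if b then negIndicator n k (R k) else negIndicator n (L k) k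

/-- The minimal values of the functionals `facetVector`. -/
def facetMin (a L R : ℕ → ℕ) (k : ℕ) (b : Bool) : ℝ :=
  if b then -((∑ i ∈ Finset.Ico k (R k), a i : ℕ) : ℝ) - (R k - k : ℕ)
  else -((∑ i ∈ Finset.Ioc (L k) k, a i : ℕ) : ℝ) - (k - L k : ℕ)

theorem isCubical_bruhatIntervalPolytope {n : ℕ} (u : Equiv.Perm (Fin n)) (L R : ℕ → ℕ)
    (hLR : ∀ k, 0 < k → k < n + 1 → R k ≤ n + 1 ∧ IsNode (valueSeq u) (L k) k (R k)) :
    IsCubical (bruhatIntervalPolytope (head u) (head u * ascendingProd n)) (Finset.Ioo 0 (n + 1))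
      (facetVector n L R) (facetMin (valueSeq u) L R) where
  sum_eq := by
    refine ⟨∑ y : Fin (n + 1), ((y : ℕ) + 1 : ℝ), ?_⟩
    refine fun x hx => convexHull_min
      (t := {x : Fin (n + 1) → ℝ | ∑ i, x i = ∑ y : Fin (n + 1), ((y : ℕ) + 1 : ℝ)}) ?_ ?_ hx
    · rintro _ ⟨z, _, _, rfl⟩
      exact Equiv.sum_comp z fun y => ((y : ℕ) + 1 : ℝ)
    · intro x hx y hy s t _ _ hst
      simp only [Set.mem_ofPred_eq] at hx hy ⊢
      simp only [Pi.add_apply, Pi.smul_apply, smul_eq_mul, Finset.sum_add_distrib,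
        ← Finset.mul_sum, hx, hy]
      rw [← add_mul, hst, one_mul]
  le_dotProduct := by
    intro k hk b x hx
    rw [Finset.mem_Ioo] at hk
    obtain ⟨hR, h1, h2, h3, h4, h5⟩ := hLR k hk.1 hk.2
    refine convexHull_min (t := {x | facetMin (valueSeq u) L R k b ≤ facetVector n L R k b ⬝ᵥ x})
      ?_ ?_ hx
    · rintro _ ⟨z, hv, hw, rfl⟩
      obtain ⟨f, hf⟩ : ∃ f : ℕ → ℕ, ∀ i : Fin (n + 1), (z i : ℕ) = f i :=
        ⟨fun j => if h : j < n + 1 then z ⟨j, h⟩ else 0, fun i => by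
          dsimp only
          rw [dif_pos i.2]⟩
      cases b
      · have h6 := sum_Ico_add_le u hv hw _ hf (p := L k) (q := k) (e := L k) h1.le (by omega) (by
          intro t ht ht'
          rcases ht.eq_or_lt with rfl | ht
          · rfl
          · rcases ht'.eq_or_lt with rfl | ht'
            · exact h3.le
            · exact (h3.trans (h5 t ht (by omega) (by omega))).le)
        have h7 := sum_Ico_eq_add_sum_Ioo (valueSeq u) (show L k < k + 1 by omega)
        have h8 : Finset.Ioo (L k) (k + 1) = Finset.Ioc (L k) k := by ext; simp
        rw [h7, h8, add_comm, add_le_add_iff_left] at h6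
        simp only [facetMin, facetVector, Bool.false_eq_true, if_false, Set.mem_ofPred_eq]
        rw [negIndicator_dotProduct_permPoint z _ hf (by omega)]
        have := (Nat.cast_le (α := ℝ)).mpr h6
        linarith
      · have h6 := sum_Ico_add_le u hv hw _ hf (p := k) (q := R k) (e := R k) h2.le (by omega) (by
          intro t ht ht'
          rcases ht'.eq_or_lt with rfl | ht'
          · rfl
          · rcases ht.eq_or_lt with rfl | ht
            · exact h4.le
            · exact (h4.trans (h5 t (by omega) ht' (by omega))).le)
        rw [Finset.sum_Ico_succ_top h2.le, add_le_add_iff_right] at h6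
        simp only [facetMin, facetVector, if_true, Set.mem_ofPred_eq]
        rw [negIndicator_dotProduct_permPoint z _ hf (by omega)]
        have := (Nat.cast_le (α := ℝ)).mpr h6
        linarith
    · intro x hx y hy s t hs ht hst
      simp only [Set.mem_ofPred_eq] at hx hy ⊢
      rw [dotProduct_add, dotProduct_smul, dotProduct_smul, smul_eq_mul, smul_eq_mul]
      calc facetMin (valueSeq u) L R k b
          = s * facetMin (valueSeq u) L R k b + t * facetMin (valueSeq u) L R k b := by
            rw [← add_mul, hst, one_mul]
        _ ≤ _ := add_le_add (mul_le_mul_of_nonneg_left hx hs) (mul_le_mul_of_nonneg_left hy ht)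
  exists_vertex := by
    intro ε
    obtain ⟨z, f, hf, hv, hw, h⟩ := exists_vertex_perm u ε
    refine ⟨permPoint z, subset_convexHull ℝ _ ⟨z, hv, hw, rfl⟩, fun k hk => ?_⟩
    rw [Finset.mem_Ioo] at hk
    obtain ⟨hR, hn⟩ := hLR k hk.1 hk.2
    have h1 := h _ _ _ hR hn
    have h2 := negIndicator_dotProduct_permPoint z f hf (p := k) hR
    have h3 := negIndicator_dotProduct_permPoint z f hf (p := L k) hk.2.le
    cases hε : ε k
    · obtain ⟨h4, h5⟩ := h1.2 hε
      have := (Nat.cast_lt (α := ℝ)).mpr h5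
      simp only [facetMin, facetVector, Bool.false_eq_true, if_false, Bool.not_false, if_true]
      rw [h2, h3, h4]
      exact ⟨rfl, by linarith⟩
    · obtain ⟨h4, h5⟩ := h1.1 hε
      have := (Nat.cast_lt (α := ℝ)).mpr h5
      simp only [facetMin, facetVector, Bool.false_eq_true, if_false, Bool.not_true, if_true]
      rw [h2, h3, h4]
      exact ⟨rfl, by linarith⟩
  exists_combination := by
    intro x
    obtain ⟨d, c, h⟩ := (isBasin_valueSeq u).exists_combination (injOn_valueSeq u) L R
      (fun k h1 h2 => (hLR k h1 h2).2) fun i => if hi : i < n + 1 then x ⟨i, hi⟩ else 0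
    -- The sign of `c k` selects the facet at `k`, and its absolute value is the coefficient.
    refine ⟨d, fun k => decide (0 ≤ c k), fun k => |c k|, fun k => abs_nonneg _, ?_⟩
    ext i
    have h1 := h i (Nat.zero_le _) i.2
    rw [dif_pos i.2] at h1
    rw [Fin.eta] at h1
    rw [h1, Pi.add_apply, Pi.smul_apply, smul_eq_mul, mul_one, Finset.sum_apply, sub_eq_add_neg,
      ← Finset.sum_neg_distrib]
    congr 1
    refine Finset.sum_congr rfl fun k _ => ?_
    rw [Pi.smul_apply, smul_eq_mul, facetVector]
    dsimp only
    rcases le_or_gt 0 (c k) with hc | hc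
    · rw [abs_of_nonneg hc, max_eq_left hc, max_eq_right (by linarith), if_pos (decide_eq_true hc),
        negIndicator]
      ring
    · rw [abs_of_neg hc, max_eq_right hc.le, max_eq_left (by linarith),
        if_neg (c := decide (0 ≤ c k) = true) (by simpa using hc), negIndicator]
      ring

theorem isV_psi_iff {n : ℕ} (u : Equiv.Perm (Fin n)) (L R : ℕ → ℕ)
    (hLR : ∀ k, 0 < k → k < n + 1 → R k ≤ n + 1 ∧ IsNode (valueSeq u) (L k) k (R k)) {k : ℕ}
    (h0 : 0 < k) (hk : k < n + 1) (x : NR n) :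
    (psi u).IsV k x ↔ x = toNR n (facetVector n L R k true) := by
  obtain ⟨hR, hn⟩ := hLR k h0 hk
  rw [facetVector, if_pos rfl, toNR_negIndicator hn.2.1.le]
  constructor
  · rintro ⟨b, ⟨a, h⟩, rfl⟩
    rw [(hn.unique (((isDistinguished_and_isTriangle_psi_iff u).mp h).2)).2]
  · rintro rfl
    exact ⟨R k, ⟨L k, (isDistinguished_and_isTriangle_psi_iff u).mpr ⟨hR, hn⟩⟩, rfl⟩

theorem isW_psi_iff {n : ℕ} (u : Equiv.Perm (Fin n)) (L R : ℕ → ℕ)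
    (hLR : ∀ k, 0 < k → k < n + 1 → R k ≤ n + 1 ∧ IsNode (valueSeq u) (L k) k (R k)) {k : ℕ}
    (h0 : 0 < k) (hk : k < n + 1) (x : NR n) :
    (psi u).IsW k x ↔ x = toNR n (facetVector n L R k false) := by
  obtain ⟨hR, hn⟩ := hLR k h0 hk
  rw [facetVector, if_neg (by simp), toNR_negIndicator hn.1.le]
  constructor
  · rintro ⟨b, ⟨a, h⟩, rfl⟩
    rw [(hn.unique (((isDistinguished_and_isTriangle_psi_iff u).mp h).2)).1]
  · rintro rfl
    exact ⟨L k, ⟨R k, (isDistinguished_and_isTriangle_psi_iff u).mpr ⟨hR, hn⟩⟩, rfl⟩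

end CatalanFan

end

/-! ### Facet choices and the cones of the triangulation -/

theorem theorem6p4 (n : ℕ) (u : Equiv.Perm (Fin n)) :
    CatalanFan.normalFan
        (CatalanFan.bruhatIntervalPolytope (CatalanFan.head u)
          (CatalanFan.head u * CatalanFan.ascendingProd n)) =
      (CatalanFan.psi u).fan := by
  open CatalanFan in
  have hex : ∀ k, ∃ p q, 0 < k → k < n + 1 → q ≤ n + 1 ∧ IsNode (valueSeq u) p k q := by
    intro k
    by_cases hk : 0 < k ∧ k < n + 1
    · obtain ⟨p, q, _, h1, h2⟩ := (isBasin_valueSeq u).exists_isNode_at (injOn_valueSeq u) k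
        hk.1 hk.2
      exact ⟨p, q, fun _ _ => ⟨h1, h2⟩⟩
    · exact ⟨0, 0, fun h1 h2 => absurd ⟨h1, h2⟩ hk⟩
  choose L R hLR using hex
  have hcub := CatalanFan.isCubical_bruhatIntervalPolytope u L R hLR
  have hV := fun k h0 hk => CatalanFan.isV_psi_iff u L R hLR (k := k) h0 hk
  have hW := fun k h0 hk => CatalanFan.isW_psi_iff u L R hLR (k := k) h0 hk
  rw [hcub.normalFan_eq]
  ext σ
  constructor
  · rintro ⟨Q, hQ, rfl⟩
    refine ⟨_, ?_, ?_, rfl⟩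
    · rintro _ ⟨⟨k, b⟩, hq, rfl⟩
      have hk := Finset.mem_Ioo.mp (hQ.1 _ hq)
      refine ⟨k, hk.1, Nat.lt_succ_iff.mp hk.2, ?_⟩
      cases b
      · exact Or.inr ((hW k hk.1 hk.2 _).mpr rfl)
      · exact Or.inl ((hV k hk.1 hk.2 _).mpr rfl)
    · intro k h1 h2 v w hv hw hsub
      rw [hV k h1 (by omega)] at hv
      rw [hW k h1 (by omega)] at hw
      have hk : k ∈ Finset.Ioo 0 (n + 1) := Finset.mem_Ioo.mpr ⟨h1, by omega⟩
      -- The cones of the fan are given by sets of vectors, the choices by sets of indices.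
      -- Distinctness of the facet vectors lets the index be recovered from the vector.
      have key : ∀ b, CatalanFan.toNR n (CatalanFan.facetVector n L R k b) ∈
          (fun q : ℕ × Bool => CatalanFan.toNR n (CatalanFan.facetVector n L R q.1 q.2)) '' Q →
          (k, b) ∈ Q := by
        rintro b ⟨⟨k', b'⟩, hq, he⟩
        obtain ⟨rfl, rfl⟩ := hcub.toNR_injective (hQ.1 _ hq) hk he
        exact hq
      exact hQ.2 k true (key true (hv ▸ hsub (by simp))) (key false (hw ▸ hsub (by simp)))
  · rintro ⟨Q, hQ, hQ', rfl⟩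
    refine ⟨{q | q.1 ∈ Finset.Ioo 0 (n + 1) ∧
      CatalanFan.toNR n (CatalanFan.facetVector n L R q.1 q.2) ∈ Q}, ⟨fun q hq => hq.1, ?_⟩, ?_⟩
    · rintro k b ⟨hk, hb⟩ ⟨_, hb'⟩
      have hk' := Finset.mem_Ioo.mp hk
      refine hQ' k hk'.1 (Nat.lt_succ_iff.mp hk'.2) _ _ ((hV k hk'.1 hk'.2 _).mpr rfl)
        ((hW k hk'.1 hk'.2 _).mpr rfl) ?_
      cases b
      · exact Set.insert_subset hb' (Set.singleton_subset_iff.mpr hb)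
      · exact Set.insert_subset hb (Set.singleton_subset_iff.mpr hb')
    -- Every ray is a facet vector, so `Q` is the image of the set of all indices whose vectors lie
    -- in it.
    · congr 1
      ext x
      constructor
      · intro hx
        obtain ⟨k, h1, h2, h3⟩ := hQ hx
        have hk : k ∈ Finset.Ioo 0 (n + 1) := Finset.mem_Ioo.mpr ⟨h1, by omega⟩
        rcases h3 with h3 | h3
        · rw [hV k h1 (by omega)] at h3
          exact ⟨(k, true), ⟨hk, h3 ▸ hx⟩, h3.symm⟩
        · rw [hW k h1 (by omega)] at h3
          exact ⟨(k, false), ⟨hk, h3 ▸ hx⟩, h3.symm⟩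
      · rintro ⟨q, hq, rfl⟩
        exact hq.2
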